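/- Let $\Gamma$ be a good resolution graph of a normal surface singularity whose link is a rational homology sphere: a finite tree with vertex set $\mathcal V$, Euler decorations $e_i\in\mathbb Z$, and negative definite intersection form $(\,,\,)$ on $L=\mathbb Z\langle E_i\rangle_{i\in\mathcal V}$, where $(E_i,E_i)=e_i$ and, for $i\neq j$, $(E_i,E_j)=1$ if $i,j$ are adjacent and $0$ otherwise. Let $L'=\{l'\in L\otimes\mathbb Q:(l',L)\subset\mathbb Z\}$, $H=L'/L$, $\mathcal S'=\{l'\in L': (l',E_i)\le 0\ \forall i\}$. Order $L\otimes\mathbb Q$ coordinatewise in the basis $\{E_i\}$, and for $h\in H$ let $s_h$ be the minimal element of $\mathcal S'$ of class $h$. Let $Z_K\in L'$ be given by $(Z_K,E_i)=(E_i,E_i)+2$ for all $i$, and put $\chi_h(l)=-\tfrac12(l,\,l-Z_K+2s_h)\in\mathbb Z$ for $l\in L$. For $l\in L$ and $I\subset\mathcal V$ let $(l,I)$ be the cube in $\mathbb R^{\mathcal V}$ with vertices $l+E_J$, $J\subset I$, where $E_J=\sum_{i\in J}E_i$, and let $w_h(l,I)=\max_{J\subset I}\chi_h(l+E_J)$.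 For $n\in\mathbb Z$ let $S_n\subset(\mathbb R_{\ge0})^{\mathcal V}$ be the intersection of $(\mathbb R_{\ge 0})^{\mathcal V}$ with the union of all cubes of weight $w_h\le n$. Fix $h\in H$ and $s\in\mathcal S'\setminus\{0\}$, and put $n_i=-(s,E_i)$, $\mathrm{Supp}(s)=\{i: n_i>0\}$, $r'=|\mathrm{Supp}(s)|$. For $\widetilde l\in\mathbb Z_{\ge0}^{r'}$ (coordinates indexed by $\mathrm{Supp}(s)$) let $d(\widetilde l)=-(s,\widetilde l)=\sum_{i\in\mathrm{Supp}(s)} n_i\widetilde l_i$ and $$\mathfrak X_{-\widetilde l}=\prod_{i\in\mathrm{Supp}(s)}[\widetilde l_i,\infty)\times\prod_{i\notin\mathrm{Supp}(s)}[0,\infty),$$ and for $d\in\mathbb Z$ let $\mathfrak X_{-d}$ be the union of the cubes $(l,I)$ with $l\ge0$ and $(s,l)\le -d$. Put $$(E^1_{-\widetilde l,q})_n=H_{-d(\widetilde l)+q}\big(S_n\cap\mathfrak X_{-\widetilde l},\ S_n\cap\mathfrak X_{-\widetilde l}\cap\mathfrak X_{-d(\widetilde l)-1};\mathbb Z\big)$$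 (cellular homology of the pair of cubical complexes) and $$\mathbf{PE}_1(\mathbf T,Q,\hbar)=\sum_{\widetilde l\in\mathbb Z_{\ge0}^{r'},\,n,\,q}\mathrm{rank}\,(E^1_{-\widetilde l,q})_n\cdot\Big(\prod_{i\in\mathrm{Supp}(s)}T_i^{n_i\widetilde l_i}\Big)Q^n\hbar^{-d(\widetilde l)+q}.$$ Let $$Z^m_h(\mathbf t,q)=\frac1{1-q}\sum_{l\in L}\sum_{I\subset\mathcal V}(-1)^{|I|}q^{w_h(l,I)}\,\mathbf t^{\,l+s_h},\qquad \mathbf t^{l'}=\prod_i t_i^{l'_i}\ \text{ for } l'=\sum_i l'_iE_i,$$ where $\frac1{1-q}=\sum_{k\ge0}q^k$. Then all the modules $(E^1_{-\widetilde l,q})_n$ are finitely generated. In $Z^m_h(\mathbf t,q)\cdot\mathbf t^{-s_h}$ the substitution $t_i\mapsto T_i^{n_i}$ for $i\in\mathrm{Supp}(s)$, $t_i\mapsto1$ for $i\notin\mathrm{Supp}(s)$, $q\mapsto Q$ is well defined (every monomial in $\mathbf T$ comes from only finitely many $\mathbf t$-monomials with nonzero coefficient), and its result is $\mathbf{PE}_1(\mathbf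 T,Q,\hbar)|_{\hbar=-1}$. -/

import Mathlib

namespace PlumbingLattice

/-! ### Formal series with rational exponents -/

/-- Formal (possibly infinite) sums `∑ a_e x^e` of monomials `x^e = ∏ x_i ^ (e i)`, `e : σ → ℚ`,
with coefficients in `R`, recorded by the coefficient function `e ↦ a_e`. -/
abbrev FormalSeries (σ R : Type*) := (σ → ℚ) → R

/-- The family of terms `a k * x ^ (e k)` can be added up formally: every monomial receives only
finitely many nonzero contributions. -/
def FormallySummable {ι σ R : Type*} [Zero R] (e : ι → σ → ℚ) (a : ι → R) : Prop :=
  ∀ c : σ → ℚ, {k | e k = c ∧ a k ≠ 0}.Finite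

/-- The formal sum `∑ k, a k * x ^ (e k)`. -/
noncomputable def formalSum {ι σ R : Type*} [AddCommMonoid R] (e : ι → σ → ℚ) (a : ι → R) :
    FormalSeries σ R :=
  fun c => ∑ᶠ k ∈ {k | e k = c}, a k

/-- The product `F * x ^ u` of a series with a monomial. -/
def mulMonomial {σ R : Type*} (F : FormalSeries σ R) (u : σ → ℚ) : FormalSeries σ R :=
  fun c => F (c - u)

/-- The substitution in `F` that replaces each monomial `x ^ a` by the monomial `y ^ (φ a)` can be
carried out. -/
def Substitutable {σ τ R : Type*} [Zero R] (φ : (σ → ℚ) → (τ → ℚ)) (F : FormalSeries σ R) :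
    Prop :=
  FormallySummable φ F

/-- The series obtained from `F` by replacing each monomial `x ^ a` by `y ^ (φ a)`. -/
noncomputable def substMonomials {σ τ R : Type*} [AddCommMonoid R] (φ : (σ → ℚ) → (τ → ℚ))
    (F : FormalSeries σ R) : FormalSeries τ R :=
  formalSum φ F

/-- The Laurent series `1 / (1 - q) = ∑_{k ≥ 0} q ^ k`. -/
noncomputable def geomSeries : LaurentSeries ℤ :=
  HahnSeries.ofPowerSeries ℤ ℤ (PowerSeries.mk fun _ => 1)

theorem geomSeries_mul : geomSeries * (1 - HahnSeries.single (1 : ℤ) (1 : ℤ)) = 1 := by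
  have h := congrArg (HahnSeries.ofPowerSeries ℤ ℤ) (PowerSeries.mk_one_mul_one_sub_eq_one ℤ)
  rw [map_mul, map_sub, map_one, HahnSeries.ofPowerSeries_X] at h
  exact h

/-! ### Cubes and cubical homology of pairs -/

variable {V : Type*} [LinearOrder V]

/-- The lattice vector `E_J = ∑_{i ∈ J} E_i`. -/
def indVec (J : Finset V) : V → ℤ := fun i => if i ∈ J then 1 else 0

/-- The pair `(l, I)` stands for the cube with vertices `l + E_J`, `J ⊆ I`. -/
abbrev Cube (V : Type*) := (V → ℤ) × Finset V

/-- The closed cube in `ℝ^V` given by `(l, I)`. -/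
def Cube.toSet (c : Cube V) : Set (V → ℝ) :=
  {x | ∀ i, (c.1 i : ℝ) ≤ x i ∧ x i ≤ (c.1 i : ℝ) + (indVec c.2 i : ℝ)}

theorem Cube.toSet_nonempty (c : Cube V) : c.toSet.Nonempty := by
  refine ⟨fun i => (c.1 i : ℝ), fun i => ⟨le_rfl, ?_⟩⟩
  by_cases h : i ∈ c.2 <;> simp [indVec, h]

/-- The face `(l, I \ {i})`. -/
def backFace (c : Cube V) (i : V) : Cube V := (c.1, c.2.erase i)

/-- The face `(l + E_i, I \ {i})`. -/
def frontFace (c : Cube V) (i : V) : Cube V := (c.1 + indVec {i}, c.2.erase i)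

/-- The sign of the pair of faces of a cube in direction `i`, for the chosen order of `V`. -/
def faceSign (I : Finset V) (i : V) : ℤ := (-1) ^ (I.filter (· < i)).card

/-- The cellular boundary of one cube. -/
noncomputable def cubeBoundary (c : Cube V) : Cube V →₀ ℤ :=
  ∑ i ∈ c.2, faceSign c.2 i •
    (Finsupp.single (frontFace c i) (1 : ℤ) - Finsupp.single (backFace c i) (1 : ℤ))

/-- The boundary operator on cubical chains; it squares to zero by `boundary_boundary`. -/
noncomputable def boundary : (Cube V →₀ ℤ) →ₗ[ℤ] (Cube V →₀ ℤ) :=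
  Finsupp.linearCombination ℤ cubeBoundary

theorem faceSign_swap {I : Finset V} {i j : V} (hi : i ∈ I) (hj : j ∈ I) (hij : i ≠ j) :
    faceSign I i * faceSign (I.erase i) j + faceSign I j * faceSign (I.erase j) i = 0 := by
  wlog h : i < j generalizing i j
  · have := this hj hi hij.symm (lt_of_le_of_ne (not_lt.mp h) hij.symm)
    rw [add_comm]; exact this
  have e1 : (I.erase j).filter (· < i) = I.filter (· < i) := by
    ext k; simp only [Finset.mem_filter, Finset.mem_erase]
    constructor
    · rintro ⟨⟨_, a⟩, b⟩; exact ⟨a, b⟩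
    · rintro ⟨a, b⟩; exact ⟨⟨(b.trans h).ne, a⟩, b⟩
  have e2 : (I.erase i).filter (· < j) = (I.filter (· < j)).erase i := by
    ext k; simp only [Finset.mem_filter, Finset.mem_erase]; tauto
  have hm : i ∈ I.filter (· < j) := by simp [hi, h]
  have e3 := Finset.card_erase_add_one hm
  simp only [faceSign, e1, e2]
  rw [← e3, pow_succ]; ring

theorem boundary_boundary (x : Cube V →₀ ℤ) : boundary (boundary x) = 0 := by
  induction x using Finsupp.induction_linear with
  | zero => simp
  | add f g hf hg => simp [hf, hg]
  | single c m =>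
    have key : boundary (cubeBoundary c) = 0 := by
      have e : boundary (cubeBoundary c) = ∑ i ∈ c.2, ∑ j ∈ c.2.erase i,
          (faceSign c.2 i * faceSign (c.2.erase i) j) •
          ((Finsupp.single (frontFace (frontFace c i) j) (1 : ℤ)
            - Finsupp.single (backFace (frontFace c i) j) 1)
          - (Finsupp.single (frontFace (backFace c i) j) 1
            - Finsupp.single (backFace (backFace c i) j) 1)) := by
        rw [cubeBoundary, map_sum]
        refine Finset.sum_congr rfl fun i _ => ?_
        rw [map_smul, map_sub]
        simp only [boundary, Finsupp.linearCombination_single, one_smul]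
        simp only [cubeBoundary, frontFace, backFace]
        rw [← Finset.sum_sub_distrib, Finset.smul_sum]
        refine Finset.sum_congr rfl fun j _ => ?_
        rw [← smul_sub, smul_smul]
      rw [e, Finset.sum_sigma']
      refine Finset.sum_involution (fun p _ => ⟨p.2, p.1⟩) ?_ ?_ ?_ ?_
      · rintro ⟨i, j⟩ h
        simp only [Finset.mem_sigma, Finset.mem_erase] at h
        obtain ⟨hi, hji, hj⟩ := h
        have hs := faceSign_swap hi hj hji.symm
        have hf : frontFace (frontFace c j) i = frontFace (frontFace c i) j := by
          simp only [frontFace, Prod.mk.injEq]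
          exact ⟨by abel, Finset.erase_right_comm⟩
        have hb : backFace (backFace c j) i = backFace (backFace c i) j := by
          simp only [backFace, Prod.mk.injEq]
          exact ⟨trivial, Finset.erase_right_comm⟩
        have h1 : frontFace (backFace c j) i = backFace (frontFace c i) j := by
          simp only [backFace, frontFace, Prod.mk.injEq]
          exact ⟨trivial, Finset.erase_right_comm⟩
        have h2 : backFace (frontFace c j) i = frontFace (backFace c i) j := by
          simp only [backFace, frontFace, Prod.mk.injEq]
          exact ⟨trivial, Finset.erase_right_comm⟩
        simp only [hf, hb, h1, h2]
        rw [eq_neg_of_add_eq_zero_right hs]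
        module
      · rintro ⟨i, j⟩ h _ heq
        simp only [Finset.mem_sigma, Finset.mem_erase] at h
        simp only [Sigma.mk.injEq] at heq
        exact h.2.1 heq.1
      · rintro ⟨i, j⟩ h
        simp only [Finset.mem_sigma, Finset.mem_erase] at h ⊢
        exact ⟨h.2.2, h.2.1.symm, h.1⟩
      · rintro ⟨i, j⟩ _; rfl
    have : boundary (Finsupp.single c m) = m • cubeBoundary c := by
      simp [boundary, Finsupp.linearCombination_single]
    rw [this, map_smul, key, smul_zero]

/-- Cubical chains (of all degrees) of a subset of `ℝ^V`: generated by the cubes it contains. -/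
noncomputable def chainsIn (A : Set (V → ℝ)) : Submodule ℤ (Cube V →₀ ℤ) :=
  Finsupp.supported ℤ ℤ {c : Cube V | c.toSet ⊆ A}

/-- Cubical chains of degree `b`: generated by the `b`-dimensional cubes contained in `A`. -/
noncomputable def chains (b : ℕ) (A : Set (V → ℝ)) : Submodule ℤ (Cube V →₀ ℤ) :=
  Finsupp.supported ℤ ℤ {c : Cube V | c.2.card = b ∧ c.toSet ⊆ A}

/-- Relative `b`-cycles of the pair `(A, B)`. -/
noncomputable def relCycles (b : ℕ) (A B : Set (V → ℝ)) : Submodule ℤ (Cube V →₀ ℤ) :=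
  chains b A ⊓ (chainsIn B).comap boundary

/-- Relative `b`-boundaries of the pair `(A, B)`. -/
noncomputable def relBoundaries (b : ℕ) (A B : Set (V → ℝ)) : Submodule ℤ (Cube V →₀ ℤ) :=
  (chains (b + 1) A).map boundary ⊔ chains b B

/-- The homology `H_b(A, B; ℤ)` of a pair `B ⊆ A` of unions of cubes, computed by the
relative cellular chain complex of the cubical decomposition. -/
abbrev RelHomology (b : ℕ) (A B : Set (V → ℝ)) : Type _ :=
  (relCycles b A B) ⧸ (relBoundaries b A B).comap (relCycles b A B).subtype

theorem chains_eq_bot {b : ℕ} {A : Set (V → ℝ)}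
    (hA : ∀ c : Cube V, c.2.card = b → ¬ c.toSet ⊆ A) : chains b A = ⊥ := by
  have : {c : Cube V | c.2.card = b ∧ c.toSet ⊆ A} = ∅ := by
    ext c; simp only [Set.mem_ofPred_eq, Set.mem_empty_iff_false, iff_false, not_and]
    exact hA c
  rw [chains, this, Finsupp.supported_empty]

theorem finrank_relHomology_eq_zero {b : ℕ} {A B : Set (V → ℝ)}
    (hA : chains b A = ⊥) : Module.finrank ℤ (RelHomology b A B) = 0 := by
  have hz : relCycles b A B = ⊥ := by rw [relCycles, hA, bot_inf_eq]
  have : Subsingleton (relCycles b A B) := by rw [hz]; infer_instance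
  have : Subsingleton (RelHomology b A B) := (Submodule.mkQ_surjective _).subsingleton
  exact Module.finrank_zero_of_subsingleton

/-! ### Resolution graphs and their lattices -/

/-- The embedding of `L = ℤ^V` in `ℚ^V`. -/
def toQ (l : V → ℤ) : V → ℚ := fun i => (l i : ℚ)

/-- The intersection matrix over `ℚ` of a graph with vertex decorations (Euler numbers). -/
noncomputable def intersectionMatrix (G : SimpleGraph V) (e : V → ℤ) : Matrix V V ℚ :=
  open Classical in
  Matrix.of fun i j => if i = j then (e i : ℚ) else if G.Adj i j then 1 else 0

/-- A (good) resolution graph of a normal surface singularity whose link is a rational homology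
sphere: a finite tree (of rational curves) with negative definite intersection form. -/
structure ResolutionGraph (V : Type*) [Fintype V] [LinearOrder V] where
  graph : SimpleGraph V
  isTree : graph.IsTree
  euler : V → ℤ
  negDef : ∀ x : V → ℚ, x ≠ 0 → x ⬝ᵥ (intersectionMatrix graph euler).mulVec x < 0

namespace ResolutionGraph

variable [Fintype V] (Γ : ResolutionGraph V)

/-- The intersection matrix. -/
noncomputable def mat : Matrix V V ℚ := intersectionMatrix Γ.graph Γ.euler

/-- The intersection form `(x, y)` on `L ⊗ ℚ = ℚ^V`. -/
noncomputable def form (x y : V → ℚ) : ℚ := x ⬝ᵥ Γ.mat.mulVec y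

/-- The basis element `E_i`. -/
def E (i : V) : V → ℚ := Pi.single i 1

theorem form_add_left (x y z : V → ℚ) : Γ.form (x + y) z = Γ.form x z + Γ.form y z := by
  simp [form, add_dotProduct]

theorem form_add_right (x y z : V → ℚ) : Γ.form x (y + z) = Γ.form x y + Γ.form x z := by
  simp [form, Matrix.mulVec_add, dotProduct_add]

theorem form_neg_left (x y : V → ℚ) : Γ.form (-x) y = -Γ.form x y := by
  simp [form]

theorem form_smul_left (a : ℚ) (x y : V → ℚ) : Γ.form (a • x) y = a * Γ.form x y := by
  simp [form]

theorem form_smul_right (a : ℚ) (x y : V → ℚ) : Γ.form x (a • y) = a * Γ.form x y := by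
  simp [form, Matrix.mulVec_smul]

theorem mat_symm : Γ.mat.transpose = Γ.mat := by
  ext i j
  simp only [mat, intersectionMatrix, Matrix.transpose_apply, Matrix.of_apply]
  by_cases h : i = j
  · subst h; simp
  · rw [if_neg h, if_neg (Ne.symm h)]
    by_cases ha : Γ.graph.Adj i j
    · rw [if_pos ha, if_pos ha.symm]
    · rw [if_neg ha, if_neg fun hb => ha hb.symm]

theorem form_comm (x y : V → ℚ) : Γ.form x y = Γ.form y x := by
  rw [form, Matrix.dotProduct_mulVec, ← Matrix.mulVec_transpose, mat_symm, dotProduct_comm, form]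

theorem form_E (x : V → ℚ) (i : V) : Γ.form x (E i) = Γ.mat.mulVec x i := by
  rw [form_comm]; simp [form, E]

theorem form_eq_sum (x y : V → ℚ) : Γ.form x y = ∑ i, y i * Γ.form x (E i) := by
  rw [form_comm]; simp only [form_E]; rfl

theorem form_self_nonpos (x : V → ℚ) : Γ.form x x ≤ 0 := by
  by_cases h : x = 0
  · simp [h, form]
  · exact (Γ.negDef x h).le

theorem isUnit_mat : IsUnit Γ.mat := by
  rw [← Matrix.mulVec_injective_iff_isUnit]
  intro x y hxy
  by_contra hne
  have h := Γ.negDef (x - y) (sub_ne_zero.mpr hne)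
  have h0 : Γ.mat.mulVec (x - y) = 0 := by
    rw [Matrix.mulVec_sub]; exact sub_eq_zero.mpr hxy
  change (x - y) ⬝ᵥ Γ.mat.mulVec (x - y) < 0 at h
  rw [h0] at h; simp at h

/-- The dual lattice `L' = {x ∈ L ⊗ ℚ : (x, L) ⊆ ℤ}`. -/
noncomputable def dualLattice : AddSubgroup (V → ℚ) where
  carrier := {x | ∀ l : V → ℤ, ∃ m : ℤ, Γ.form x (toQ l) = m}
  zero_mem' := fun l => ⟨0, by simp [form]⟩
  add_mem' := by
    intro x y hx hy l
    obtain ⟨a, ha⟩ := hx l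
    obtain ⟨b, hb⟩ := hy l
    exact ⟨a + b, by rw [form_add_left, ha, hb]; push_cast; rfl⟩
  neg_mem' := by
    intro x hx l
    obtain ⟨a, ha⟩ := hx l
    exact ⟨-a, by rw [form_neg_left, ha]; push_cast; rfl⟩

/-- The lattice `L` as a subgroup of `L'`. -/
noncomputable def lattice : AddSubgroup Γ.dualLattice where
  carrier := {x | ∃ l : V → ℤ, (x : V → ℚ) = toQ l}
  zero_mem' := ⟨0, by ext i; simp [toQ]⟩
  add_mem' := by
    rintro x y ⟨a, ha⟩ ⟨b, hb⟩
    exact ⟨a + b, by ext i; simp [ha, hb, toQ]⟩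
  neg_mem' := by
    rintro x ⟨a, ha⟩
    exact ⟨-a, by ext i; simp [ha, toQ]⟩

/-- The group `H = L' / L`. -/
abbrev H : Type _ := Γ.dualLattice ⧸ Γ.lattice

/-- The Lipman cone `S' = {l' ∈ L' : (l', E_i) ≤ 0 for all i}`. -/
def lipmanCone : Set (V → ℚ) :=
  {x | x ∈ Γ.dualLattice ∧ ∀ i, Γ.form x (E i) ≤ 0}

/-- The elements of the Lipman cone of class `h ∈ L' / L`. -/
def lipmanClass (h : Γ.H) : Set (V → ℚ) :=
  {x | x ∈ Γ.lipmanCone ∧ ∃ hx : x ∈ Γ.dualLattice, (QuotientAddGroup.mk ⟨x, hx⟩ : Γ.H) = h}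

theorem toQ_mem (l : V → ℤ) : toQ l ∈ Γ.dualLattice := by
  intro k
  refine ⟨∑ i, ∑ j, l i * ((if i = j then Γ.euler i else
    open Classical in if Γ.graph.Adj i j then 1 else 0) * k j), ?_⟩
  simp only [form, dotProduct, Matrix.mulVec, mat, intersectionMatrix, Matrix.of_apply, toQ]
  push_cast
  refine Finset.sum_congr rfl fun i _ => ?_
  rw [Finset.mul_sum]

/-- Elements of `L'` of the same class differ by an element of `L`, and conversely. -/
theorem mk_eq_mk_iff {x y : V → ℚ} (hx : x ∈ Γ.dualLattice) (hy : y ∈ Γ.dualLattice) :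
    (QuotientAddGroup.mk ⟨x, hx⟩ : Γ.H) = QuotientAddGroup.mk ⟨y, hy⟩ ↔
      ∃ l : V → ℤ, y = x + toQ l := by
  rw [QuotientAddGroup.eq]
  constructor
  · rintro ⟨l, hl⟩
    refine ⟨l, ?_⟩
    rw [← hl]; simp
  · rintro ⟨l, hl⟩
    exact ⟨l, by simp [hl]⟩

theorem lipmanCone_nonneg {x : V → ℚ} (hx : x ∈ Γ.lipmanCone) (i : V) : 0 ≤ x i := by
  set p : V → ℚ := fun i => max (x i) 0 with hp
  set m : V → ℚ := fun i => max (-x i) 0 with hm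
  have hxpm : x + m = p := by
    ext i; simp only [hp, hm, Pi.add_apply]
    rcases le_total 0 (x i) with h | h
    · rw [max_eq_left h, max_eq_right (by linarith)]; ring
    · rw [max_eq_right h, max_eq_left (by linarith)]; ring
  have hm0 : ∀ i, 0 ≤ m i := fun i => le_max_right _ _
  have hp0 : ∀ i, 0 ≤ p i := fun i => le_max_right _ _
  have h1 : Γ.form x m ≤ 0 := by
    rw [form_eq_sum]
    exact Finset.sum_nonpos fun i _ => mul_nonpos_of_nonneg_of_nonpos (hm0 i) (hx.2 i)
  have h2 : 0 ≤ Γ.form p m := by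
    simp only [form, dotProduct, Matrix.mulVec, Finset.mul_sum]
    refine Finset.sum_nonneg fun i _ => Finset.sum_nonneg fun j _ => ?_
    by_cases hij : i = j
    · subst hij
      have : p i * m i = 0 := by
        simp only [hp, hm]
        rcases le_total 0 (x i) with h | h
        · rw [max_eq_right (a := -x i) (by linarith)]; ring
        · rw [max_eq_right h]; ring
      have e : p i * (Γ.mat i i * m i) = Γ.mat i i * (p i * m i) := by ring
      rw [e, this, mul_zero]
    · have : 0 ≤ Γ.mat i j := by
        simp only [mat, intersectionMatrix, Matrix.of_apply, hij, if_false]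
        split_ifs <;> norm_num
      exact mul_nonneg (hp0 i) (mul_nonneg this (hm0 j))
  have h3 : 0 ≤ Γ.form m m := by
    rw [← hxpm, form_add_left] at h2; linarith
  have h4 : m = 0 := by
    by_contra hne
    have := Γ.negDef m hne
    exact absurd h3 (not_le.mpr this)
  have := congrFun h4 i
  simp only [hm, Pi.zero_apply] at this
  have h5 := le_max_left (-x i) 0
  linarith

theorem lipmanClass_nonempty (h : Γ.H) : (Γ.lipmanClass h).Nonempty := by
  obtain ⟨⟨x, hx⟩, rfl⟩ := QuotientAddGroup.mk_surjective h
  -- a rational solution of `(y, E_i) = -1`, made integral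
  set y : V → ℚ := Γ.mat⁻¹.mulVec (fun _ => -1) with hy
  have hyE : ∀ i, Γ.form y (E i) = -1 := by
    intro i
    rw [form_E, hy, Matrix.mulVec_mulVec, Matrix.mul_nonsing_inv _
      ((Matrix.isUnit_iff_isUnit_det _).mp Γ.isUnit_mat), Matrix.one_mulVec]
  set D : ℕ := ∏ i, (y i).den with hD
  have hDpos : 0 < D := Finset.prod_pos fun i _ => (y i).pos
  have hint : ∀ i, ∃ z : ℤ, (D : ℚ) * y i = z := by
    intro i
    obtain ⟨k, hk⟩ := Finset.dvd_prod_of_mem (fun i => (y i).den) (Finset.mem_univ i)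
    refine ⟨k * (y i).num, ?_⟩
    have : (D : ℚ) = (y i).den * k := by rw [hD, hk]; push_cast; rfl
    rw [this]; push_cast
    have := Rat.mul_den_eq_num (y i)
    linear_combination (k : ℚ) * this
  choose l hl using hint
  have hlQ : toQ l = (D : ℚ) • y := by ext i; simp [toQ, hl i]
  obtain ⟨N, hN⟩ : ∃ N : ℕ, ∀ i, Γ.form x (E i) ≤ N := by
    obtain ⟨N, hN⟩ := exists_nat_ge (∑ i, |Γ.form x (E i)|)
    refine ⟨N, fun i => le_trans (le_abs_self _) (le_trans ?_ hN)⟩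
    exact Finset.single_le_sum (f := fun i => |Γ.form x (E i)|) (fun _ _ => abs_nonneg _)
      (Finset.mem_univ i)
  have hNl : toQ ((N : ℤ) • l) = (N : ℚ) • toQ l := by ext i; simp [toQ]
  have hmem : x + toQ ((N : ℤ) • l) ∈ Γ.dualLattice := add_mem hx (Γ.toQ_mem _)
  refine ⟨x + toQ ((N : ℤ) • l), ⟨hmem, fun i => ?_⟩, hmem, ?_⟩
  · rw [form_add_left, hNl, form_smul_left, hlQ, form_smul_left, hyE]
    have h1 : (1 : ℚ) ≤ D := by exact_mod_cast hDpos
    have h2 : (0 : ℚ) ≤ N := Nat.cast_nonneg N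
    have := hN i
    nlinarith
  · exact ((Γ.mk_eq_mk_iff hx hmem).mpr ⟨_, rfl⟩).symm

theorem lipmanClass_inf {h : Γ.H} {x y : V → ℚ} (hx : x ∈ Γ.lipmanClass h)
    (hy : y ∈ Γ.lipmanClass h) : x ⊓ y ∈ Γ.lipmanClass h := by
  obtain ⟨⟨hxL, hxE⟩, _, hxh⟩ := hx
  obtain ⟨⟨hyL, hyE⟩, _, hyh⟩ := hy
  obtain ⟨l, hl⟩ := (Γ.mk_eq_mk_iff hxL hyL).mp (hxh.trans hyh.symm)
  have hinf : x ⊓ y = x + toQ (l ⊓ 0) := by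
    ext i
    simp only [hl, Pi.inf_apply, Pi.add_apply, toQ, Pi.zero_apply]
    rcases le_total 0 (l i) with h0 | h0
    · have : (0 : ℚ) ≤ l i := by exact_mod_cast h0
      rw [inf_eq_left.mpr (by linarith), inf_eq_right.mpr h0]; simp
    · have : (l i : ℚ) ≤ 0 := by exact_mod_cast h0
      rw [inf_eq_right.mpr (by linarith), inf_eq_left.mpr h0]
  have hmem : x ⊓ y ∈ Γ.dualLattice := by rw [hinf]; exact add_mem hxL (Γ.toQ_mem _)
  have hmono : ∀ (u v : V → ℚ) (i : V), u ≤ v → u i = v i → Γ.form u (E i) ≤ Γ.form v (E i) := by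
    intro u v i huv hi
    simp only [form_E, Matrix.mulVec, dotProduct]
    refine Finset.sum_le_sum fun j _ => ?_
    by_cases hij : i = j
    · subst hij; rw [hi]
    · have : 0 ≤ Γ.mat i j := by
        simp only [mat, intersectionMatrix, Matrix.of_apply, hij, if_false]
        split_ifs <;> norm_num
      exact mul_le_mul_of_nonneg_left (huv j) this
  refine ⟨⟨hmem, fun i => ?_⟩, hmem, ?_⟩
  · rcases le_total (x i) (y i) with h0 | h0
    · exact (hmono _ _ i inf_le_left (by simp [h0])).trans (hxE i)
    · exact (hmono _ _ i inf_le_right (by simp [h0])).trans (hyE i)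
  · rw [← hxh]
    exact ((Γ.mk_eq_mk_iff hxL hmem).mpr ⟨_, hinf⟩).symm

/-- Each class has a unique minimal representative in the Lipman cone. -/
theorem exists_isLeast (h : Γ.H) : ∃ x, IsLeast (Γ.lipmanClass h) x := by
  obtain ⟨x0, hx0⟩ := Γ.lipmanClass_nonempty h
  have hmin : ∀ i, ∃ x ∈ Γ.lipmanClass h, ∀ y ∈ Γ.lipmanClass h, x i ≤ y i := by
    intro i
    have hdiff : ∀ y ∈ Γ.lipmanClass h, ∃ z : ℤ, y i = x0 i + z := by
      rintro y ⟨_, hyL, hyh⟩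
      obtain ⟨_, hxL, hxh⟩ := hx0
      obtain ⟨l, hl⟩ := (Γ.mk_eq_mk_iff hxL hyL).mp (hxh.trans hyh.symm)
      exact ⟨l i, by rw [hl]; simp [toQ]⟩
    obtain ⟨z, ⟨x, hx, hxz⟩, hz⟩ := Int.exists_least_of_bdd
      (P := fun z : ℤ => ∃ y ∈ Γ.lipmanClass h, y i = x0 i + z)
      ⟨-⌈x0 i⌉, by
        rintro z ⟨y, hy, hyz⟩
        have h1 := Γ.lipmanCone_nonneg hy.1 i
        have h2 := Int.le_ceil (x0 i)
        have h3 : (-(⌈x0 i⌉ : ℤ) : ℚ) ≤ z := by linarith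
        exact_mod_cast h3⟩
      ⟨0, x0, hx0, by simp⟩
    refine ⟨x, hx, fun y hy => ?_⟩
    obtain ⟨w, hw⟩ := hdiff y hy
    have : (z : ℚ) ≤ w := by exact_mod_cast hz w ⟨y, hy, hw⟩
    rw [hxz, hw]; linarith
  choose f hf hfmin using hmin
  have key : ∀ s : Finset V, ∃ x ∈ Γ.lipmanClass h, ∀ i ∈ s, x ≤ f i := by
    intro s
    induction s using Finset.induction_on with
    | empty => exact ⟨x0, hx0, by simp⟩
    | insert a s _ ih =>
      obtain ⟨x, hx, hxs⟩ := ih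
      refine ⟨x ⊓ f a, Γ.lipmanClass_inf hx (hf a), ?_⟩
      intro i hi
      rcases Finset.mem_insert.mp hi with rfl | hi
      · exact inf_le_right
      · exact inf_le_left.trans (hxs i hi)
  obtain ⟨x, hx, hxs⟩ := key Finset.univ
  exact ⟨x, hx, fun y hy i => (hxs i (Finset.mem_univ i) i).trans (hfmin i y hy)⟩

/-- The minimal element `s_h` of the Lipman cone in the class `h`. -/
noncomputable def sMin (h : Γ.H) : V → ℚ := (Γ.exists_isLeast h).choose

theorem sMin_isLeast (h : Γ.H) : IsLeast (Γ.lipmanClass h) (Γ.sMin h) :=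
  (Γ.exists_isLeast h).choose_spec

/-- The anticanonical cycle, determined by the adjunction formulae. -/
noncomputable def ZK : V → ℚ := Γ.mat⁻¹.mulVec (fun i => Γ.form (E i) (E i) + 2)

theorem adjunction (i : V) : Γ.form Γ.ZK (E i) = Γ.form (E i) (E i) + 2 := by
  rw [form_E, ZK, Matrix.mulVec_mulVec, Matrix.mul_nonsing_inv _
      ((Matrix.isUnit_iff_isUnit_det _).mp Γ.isUnit_mat), Matrix.one_mulVec]

/-- The distinguished characteristic element `k_h = -Z_K + 2 s_h`. -/
noncomputable def kChar (h : Γ.H) : V → ℚ := -Γ.ZK + (2 : ℚ) • Γ.sMin h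

/-- The Riemann--Roch expression `-(l, l + k_h) / 2`, as a rational number. -/
noncomputable def chiQ (h : Γ.H) (l : V → ℤ) : ℚ :=
  -(Γ.form (toQ l) (toQ l + Γ.kChar h)) / 2

/-- The weight function `χ_h : L → ℤ`, `χ_h(l) = -(l, l + k_h) / 2`; the floor is exact, see
`chi_eq`. -/
noncomputable def chi (h : Γ.H) (l : V → ℤ) : ℤ := ⌊Γ.chiQ h l⌋

theorem form_self_even (l : V → ℤ) :
    ∃ m : ℤ, Γ.form (toQ l) (toQ l - Γ.ZK) = 2 * m := by
  classical
  let a : V → V → ℤ := fun i j => if i = j then 0 else if Γ.graph.Adj i j then l i * l j else 0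
  have hself : ∀ i, Γ.form (E i) (E i) = Γ.euler i := by
    intro i; rw [form_E]; simp [E, mat, intersectionMatrix]
  have hoff : (2 : ℤ) ∣ ∑ i, ∑ j, a i j := by
    refine (ZMod.intCast_zmod_eq_zero_iff_dvd _ 2).mp ?_
    push_cast
    rw [← Finset.sum_product']
    refine Finset.sum_involution (fun p _ => (p.2, p.1)) ?_ ?_ ?_ ?_
    · rintro ⟨i, j⟩ _
      have : a j i = a i j := by
        simp only [a, Γ.graph.adj_comm j i, eq_comm (a := j), mul_comm (l j)]
      simp only [this]
      exact CharTwo.add_self_eq_zero _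
    · rintro ⟨i, j⟩ _ hne heq
      simp only [Prod.mk.injEq] at heq
      apply hne; simp [a, heq.1]
    · simp
    · simp
  obtain ⟨u, hu⟩ := hoff
  have hdiag : (2 : ℤ) ∣ ∑ i, Γ.euler i * (l i * (l i - 1)) := by
    refine Finset.dvd_sum fun i _ => Dvd.dvd.mul_left ?_ _
    exact (Int.even_mul_pred_self (l i)).two_dvd
  obtain ⟨v, hv⟩ := hdiag
  refine ⟨u + v - ∑ i, l i, ?_⟩
  have h1 : Γ.form (toQ l) (toQ l) = ∑ i, ((Γ.euler i : ℚ) * l i * l i) + ∑ i, ∑ j, (a i j : ℚ) := by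
    simp only [form, dotProduct, Matrix.mulVec]
    rw [← Finset.sum_add_distrib]
    refine Finset.sum_congr rfl fun i _ => ?_
    have : (Γ.euler i : ℚ) * l i * l i = ∑ j, if i = j then (Γ.euler i : ℚ) * l i * l j else 0 := by
      simp
    rw [this, ← Finset.sum_add_distrib, Finset.mul_sum]
    refine Finset.sum_congr rfl fun j _ => ?_
    simp only [mat, intersectionMatrix, Matrix.of_apply, toQ, a]
    by_cases hij : i = j
    · subst hij; simp; ring
    · by_cases hadj : Γ.graph.Adj i j <;> simp [hij, hadj]
  have h2 : Γ.form (toQ l) Γ.ZK = ∑ i, (l i : ℚ) * (Γ.euler i + 2) := by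
    rw [form_comm, form_eq_sum]
    refine Finset.sum_congr rfl fun i _ => ?_
    rw [adjunction, hself]; rfl
  have h3 : Γ.form (toQ l) (toQ l - Γ.ZK) = Γ.form (toQ l) (toQ l) - Γ.form (toQ l) Γ.ZK := by
    have := Γ.form_add_right (toQ l) (toQ l - Γ.ZK) Γ.ZK
    rw [sub_add_cancel] at this; linarith
  have hu' : ∑ i, ∑ j, (a i j : ℚ) = 2 * u := by exact_mod_cast hu
  have hv' : ∑ i, (Γ.euler i : ℚ) * ((l i : ℚ) * ((l i : ℚ) - 1)) = 2 * v := by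
    exact_mod_cast hv
  rw [h3, h1, h2, hu']
  push_cast
  have : ∑ i, ((Γ.euler i : ℚ) * l i * l i) - ∑ i, (l i : ℚ) * (Γ.euler i + 2)
      = 2 * v - 2 * ∑ i, (l i : ℚ) := by
    rw [← hv', Finset.mul_sum, ← Finset.sum_sub_distrib, ← Finset.sum_sub_distrib]
    exact Finset.sum_congr rfl fun i _ => by ring
  linarith

theorem chi_eq (h : Γ.H) (l : V → ℤ) : (Γ.chi h l : ℚ) = Γ.chiQ h l := by
  obtain ⟨m, hm⟩ := Γ.form_self_even l
  obtain ⟨k, hk⟩ := (Γ.sMin_isLeast h).1.1.1 l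
  have : Γ.chiQ h l = ((-m - k : ℤ) : ℚ) := by
    have e : toQ l + Γ.kChar h = (toQ l - Γ.ZK) + (2 : ℚ) • Γ.sMin h := by
      rw [kChar]; abel
    rw [chiQ, e, form_add_right, hm, form_smul_right, form_comm _ _ (Γ.sMin h), hk]
    push_cast; ring
  rw [chi, this, Int.floor_intCast]

theorem exists_le_chi (h : Γ.H) : ∃ M : ℤ, ∀ l, M ≤ Γ.chi h l := by
  set k := Γ.kChar h
  refine ⟨⌊Γ.form k k / 8⌋, fun l => Int.floor_le_floor ?_⟩
  have h0 := Γ.form_self_nonpos (toQ l + (1 / 2 : ℚ) • k)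
  simp only [form_add_left, form_add_right, form_smul_left, form_smul_right] at h0
  rw [chiQ, form_add_right]
  rw [Γ.form_comm k (toQ l)] at h0
  linarith

/-! ### Weighted cubes, filtrations, and the two series -/

/-- The weight `w_h(l, I)` of a cube: the maximum of `χ_h` over its vertices. -/
noncomputable def weight (h : Γ.H) (c : Cube V) : ℤ :=
  c.2.powerset.sup' ⟨∅, Finset.empty_mem_powerset _⟩ fun J => Γ.chi h (c.1 + indVec J)

/-- The space `S_n` in the quadrant `(ℝ_{≥ 0})^V`: the union of the cubes of weight at most `n`,
intersected with the quadrant. -/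
def S (h : Γ.H) (n : ℤ) : Set (V → ℝ) :=
  (⋃ c ∈ {c : Cube V | Γ.weight h c ≤ n}, c.toSet) ∩ {x | ∀ i, 0 ≤ x i}

/-- `X_{-d}`: the union of the cubes `(l, I)` with `l ≥ 0` and `(s, l) ≤ -d`. -/
def X (s : V → ℚ) (d : ℚ) : Set (V → ℝ) :=
  ⋃ c ∈ {c : Cube V | 0 ≤ c.1 ∧ Γ.form s (toQ c.1) ≤ -d}, c.toSet

/-- `Supp(s) = {i : (s, E_i) < 0}`. -/
def supp (s : V → ℚ) : Set V := {i | Γ.form s (E i) < 0}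

/-- The coefficient `n_i = -(s, E_i)` of `E_i^*` in `s`. -/
noncomputable def mult (s : V → ℚ) (i : V) : ℚ := -Γ.form s (E i)

/-- The inclusion of the nonnegative elements of `L_{Supp(s)}` in `L`. -/
noncomputable def extend (s : V → ℚ) (lt : Γ.supp s → ℕ) : V → ℤ :=
  open Classical in
  fun i => if hi : i ∈ Γ.supp s then (lt ⟨i, hi⟩ : ℤ) else 0

/-- `d(l̃) = -(s, l̃)`. -/
noncomputable def deg (s : V → ℚ) (lt : Γ.supp s → ℕ) : ℚ := -Γ.form s (toQ (Γ.extend s lt))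

/-- `X_{-l̃} = ∏_{i ∈ Supp(s)} [l̃_i, ∞) × ∏_{i ∉ Supp(s)} [0, ∞)`. -/
def Xmulti (s : V → ℚ) (lt : Γ.supp s → ℕ) : Set (V → ℝ) :=
  {x | (∀ i : Γ.supp s, (lt i : ℝ) ≤ x i) ∧ ∀ i ∉ Γ.supp s, 0 ≤ x i}

/-- The module `(E^1_{-l̃, q})_n = H_b(S_n ∩ X_{-l̃}, S_n ∩ X_{-l̃} ∩ X_{-d(l̃)-1}; ℤ)`, indexed by
the homological degree `b = -d(l̃) + q`. -/
abbrev E1 (h : Γ.H) (s : V → ℚ) (lt : Γ.supp s → ℕ) (n : ℤ) (b : ℕ) : Type _ :=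
  RelHomology b (Γ.S h n ∩ Γ.Xmulti s lt)
    (Γ.S h n ∩ Γ.Xmulti s lt ∩ Γ.X s (Γ.deg s lt + 1))

theorem S_eq_empty {h : Γ.H} {M n : ℤ} (hM : ∀ l, M ≤ Γ.chi h l) (hn : n < M) :
    Γ.S h n = ∅ := by
  rw [Set.eq_empty_iff_forall_notMem]
  rintro x ⟨hx, _⟩
  simp only [Set.mem_ofPred_eq, Set.mem_iUnion] at hx
  obtain ⟨c, hc, _⟩ := hx
  have h1 : Γ.chi h (c.1 + indVec ∅) ≤ Γ.weight h c :=
    Finset.le_sup' (fun J => Γ.chi h (c.1 + indVec J)) (Finset.empty_mem_powerset c.2)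
  have := hM (c.1 + indVec ∅)
  omega

/-- The ranks of `(E^1_{-l̃, q})_n` vanish for `n` very negative. -/
theorem bddBelow_rank (h : Γ.H) (s : V → ℚ) (lt : Γ.supp s → ℕ) (b : ℕ) :
    BddBelow (Function.support fun n : ℤ => (Module.finrank ℤ (Γ.E1 h s lt n b) : ℤ)) := by
  obtain ⟨M, hM⟩ := Γ.exists_le_chi h
  refine ⟨M, fun n hn => ?_⟩
  by_contra hlt
  apply hn
  have hS := Γ.S_eq_empty hM (not_le.mp hlt)
  have : Module.finrank ℤ (Γ.E1 h s lt n b) = 0 := by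
    refine finrank_relHomology_eq_zero (chains_eq_bot fun c _ hc => ?_)
    obtain ⟨x, hx⟩ := c.toSet_nonempty
    have := (hc hx).1
    rw [hS] at this
    exact this
  simp [this]

/-- The ranks of `(E^1_{-l̃, q})_n` vanish in homological degrees above `|V|`. -/
theorem rank_eq_zero_of_card_lt (h : Γ.H) (s : V → ℚ) (lt : Γ.supp s → ℕ) (n : ℤ) {b : ℕ}
    (hb : Fintype.card V < b) : Module.finrank ℤ (Γ.E1 h s lt n b) = 0 := by
  refine finrank_relHomology_eq_zero (chains_eq_bot fun c hc _ => ?_)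
  have := Finset.card_le_univ c.2
  omega

/-- The coefficient `∑_{n, b} rank (E^1_{-l̃, q})_n Q^n ħ^b` (with `b = -d(l̃) + q`), a polynomial in
`ħ` over the Laurent series in `Q`; there is nothing in degrees `b < 0` and `b > |V|`. -/
noncomputable def PE1coeff (h : Γ.H) (s : V → ℚ) (lt : Γ.supp s → ℕ) :
    Polynomial (LaurentSeries ℤ) :=
  ∑ b ∈ Finset.range (Fintype.card V + 1),
    Polynomial.monomial b
      (HahnSeries.ofSuppBddBelow (fun n : ℤ => (Module.finrank ℤ (Γ.E1 h s lt n b) : ℤ))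
        (Γ.bddBelow_rank h s lt b))

/-- The multivariable series `PE_1(T, Q, ħ) =
∑_{l̃, n, q} rank (E^1_{-l̃, q})_n (∏_{i ∈ Supp(s)} T_i ^ (n_i l̃_i)) Q^n ħ^(-d(l̃) + q)`. -/
noncomputable def PE1 (h : Γ.H) (s : V → ℚ) :
    FormalSeries (Γ.supp s) (Polynomial (LaurentSeries ℤ)) :=
  formalSum (fun (lt : Γ.supp s → ℕ) i => Γ.mult s i * lt i) (Γ.PE1coeff h s)

/-- The specialization `PE_1(T, Q, ħ = -1)`. -/
noncomputable def PE1AtNegOne (h : Γ.H) (s : V → ℚ) :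
    FormalSeries (Γ.supp s) (LaurentSeries ℤ) :=
  fun c => (Γ.PE1 h s c).eval (-1)

/-- The coefficient `(1 / (1 - q)) ∑_{I ⊆ V} (-1)^{|I|} q^{w_h(l, I)}`. -/
noncomputable def Zmcoeff (h : Γ.H) (l : V → ℤ) : LaurentSeries ℤ :=
  geomSeries * ∑ I : Finset V, (-1 : LaurentSeries ℤ) ^ I.card *
    HahnSeries.single (Γ.weight h (l, I)) (1 : ℤ)

/-- The motivic topological Poincaré series
`Z^m_h(t, q) = (1 / (1 - q)) ∑_{l ∈ L} ∑_{I ⊆ V} (-1)^{|I|} q^{w_h(l, I)} t^{l + s_h}`. -/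
noncomputable def Zm (h : Γ.H) : FormalSeries V (LaurentSeries ℤ) :=
  formalSum (fun l : V → ℤ => toQ l + Γ.sMin h) (Γ.Zmcoeff h)

/-- The effect on exponents of `t_i ↦ T_i ^ n_i` for `i ∈ Supp(s)` and `t_i ↦ 1` for
`i ∉ Supp(s)`. -/
noncomputable def substExponent (s : V → ℚ) (a : V → ℚ) : Γ.supp s → ℚ :=
  fun i => Γ.mult s i * a i

end ResolutionGraph

end PlumbingLattice

namespace PlumbingLattice

/-! ### Ranks of relative cubical homology groups -/

section Euler

/-! At `ħ = -1` the ranks at a fixed `l̃` and `n` add up to the Euler characteristic of the pair,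
hence to a signed count of its relative cells (`sum_neg_one_pow_finrank_relHomology`). As the
numbers `n_i` on the support are positive integers, raising a support coordinate above `l̃_i` pushes
a cube into `X_{-d(l̃)-1}`. The relative cells are therefore the cubes `(l, I)` of weight at most
`n` with `l ≥ 0` and `l = l̃` on the support (`relative_cell_iff`).

On the other side, the factor `1/(1-q)` makes the `q^n` coefficient at `l` the signed count of the
cubes `(l, I)` of weight at most `n` (`coeff_Zmcoeff`), and the substitution sums over all `l` with
prescribed support coordinates. The condition `l ≥ 0` comes for free: if `(l + s_h, E_i) > 0`, the
cubes with and without direction `i` cancel, so only points with `l + s_h` in the Lipman cone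
survive, and these dominate `s_h` by minimality (`nonneg_of_Zmcoeff_ne_zero`).

Two finiteness facts make the sums legitimate: negative definiteness makes the sublevel sets of
`χ_h` finite, and in the Lipman cone of a connected graph a bound on one coordinate bounds all of
them. -/

/-- Rank–nullity for `f` restricted to `P`; it serves both for the reduced differential on chains
and for `mkQ` on the relative boundaries. -/
theorem finrank_map_add_finrank_inf_ker {M M' : Type*} [AddCommGroup M] [AddCommGroup M']
    (f : M →ₗ[ℤ] M') (P : Submodule ℤ M) [Module.Finite ℤ P] :
    Module.finrank ℤ (P.map f) + Module.finrank ℤ (P ⊓ f.ker : Submodule ℤ M) =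
      Module.finrank ℤ P := by
  have h1 := Submodule.finrank_quotient_add_finrank (f.domRestrict P).ker
  rw [(f.domRestrict P).quotKerEquivRange.finrank_eq, LinearMap.range_domRestrict] at h1
  have h2 : Module.finrank ℤ (f.domRestrict P).ker =
      Module.finrank ℤ (P ⊓ f.ker : Submodule ℤ M) := by
    rw [LinearMap.ker_domRestrict]
    have e := (Submodule.equivMapOfInjective P.subtype P.injective_subtype
      (f.ker.comap P.subtype)).finrank_eq
    rw [e, Submodule.map_comap_subtype]
  rw [← h1, h2]

theorem finrank_quotient_comap_subtype {M : Type*} [AddCommGroup M] {N Z : Submodule ℤ M}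
    [Module.Finite ℤ Z] (hNZ : N ≤ Z) :
    Module.finrank ℤ (Z ⧸ N.comap Z.subtype) + Module.finrank ℤ N = Module.finrank ℤ Z := by
  rw [← (Submodule.comapSubtypeEquivOfLe hNZ).finrank_eq]
  exact Submodule.finrank_quotient_add_finrank _

variable {V : Type*} [LinearOrder V]

/-! ### Faces of cubes and the relative chain complex of a pair. -/

theorem indVec_of_notMem {J : Finset V} {i : V} (hi : i ∉ J) : indVec J i = 0 := if_neg hi

theorem indVec_nonneg (J : Finset V) (i : V) : 0 ≤ indVec J i := by
  unfold indVec; split_ifs <;> norm_num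

theorem frontFace_toSet_subset {c : Cube V} {i : V} (hi : i ∈ c.2) :
    (frontFace c i).toSet ⊆ c.toSet := by
  intro x hx j
  have h := hx j
  by_cases hj : j = i
  · subst hj
    simp [frontFace, indVec, hi] at h ⊢
    constructor <;> linarith [h.1, h.2]
  · simpa [frontFace, indVec, hj] using h

theorem backFace_toSet_subset {c : Cube V} {i : V} (hi : i ∈ c.2) :
    (backFace c i).toSet ⊆ c.toSet := by
  intro x hx j
  have h := hx j
  by_cases hj : j = i
  · subst hj
    simp [backFace, indVec, hi] at h ⊢
    constructor <;> linarith [h.1, h.2]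
  · simpa [backFace, indVec, hj] using h

/-- A set of cubes that contains the codimension one faces of the cubes of `s` supports the
boundaries of the chains supported on `s`. -/
theorem boundary_mem_supported {s t : Set (Cube V)}
    (hf : ∀ c ∈ s, ∀ i ∈ c.2, frontFace c i ∈ t) (hb : ∀ c ∈ s, ∀ i ∈ c.2, backFace c i ∈ t)
    {x : Cube V →₀ ℤ} (hx : x ∈ Finsupp.supported ℤ ℤ s) :
    boundary x ∈ Finsupp.supported ℤ ℤ t := by
  rw [boundary, Finsupp.linearCombination_apply]
  refine Submodule.sum_mem _ fun c hc => Submodule.smul_mem _ _ ?_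
  have hcs : c ∈ s := (Finsupp.mem_supported ℤ x).mp hx hc
  refine Submodule.sum_mem _ fun i hi => Submodule.smul_mem _ _ (Submodule.sub_mem _ ?_ ?_)
  · exact Finsupp.single_mem_supported ℤ _ (hf c hcs i hi)
  · exact Finsupp.single_mem_supported ℤ _ (hb c hcs i hi)

theorem boundary_mem_chainsIn {B : Set (V → ℝ)} {x : Cube V →₀ ℤ} (hx : x ∈ chainsIn B) :
    boundary x ∈ chainsIn B :=
  boundary_mem_supported (fun _ hc _ hi => (frontFace_toSet_subset hi).trans hc)
    (fun _ hc _ hi => (backFace_toSet_subset hi).trans hc) hx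

theorem boundary_mem_chains {b : ℕ} {A : Set (V → ℝ)} {x : Cube V →₀ ℤ}
    (hx : x ∈ chains (b + 1) A) : boundary x ∈ chains b A := by
  refine boundary_mem_supported (s := {c | c.2.card = b + 1 ∧ c.toSet ⊆ A})
    (t := {c | c.2.card = b ∧ c.toSet ⊆ A})
    (fun c hc i hi => ⟨?_, (frontFace_toSet_subset hi).trans hc.2⟩)
    (fun c hc i hi => ⟨?_, (backFace_toSet_subset hi).trans hc.2⟩) hx
  · have := hc.1
    simp only [frontFace, Finset.card_erase_of_mem hi]; omega
  · have := hc.1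
    simp only [backFace, Finset.card_erase_of_mem hi]; omega

theorem chains_mono (b : ℕ) {A B : Set (V → ℝ)} (h : B ⊆ A) : chains b B ≤ chains b A :=
  Finsupp.supported_mono fun _ hc => ⟨hc.1, hc.2.trans h⟩

theorem chains_le_chainsIn (b : ℕ) (A : Set (V → ℝ)) : chains b A ≤ chainsIn A :=
  Finsupp.supported_mono fun _ hc => hc.2

theorem chains_inf_chainsIn (b : ℕ) {A B : Set (V → ℝ)} (h : B ⊆ A) :
    chains b A ⊓ chainsIn B = chains b B := by
  rw [chains, chainsIn, ← Finsupp.supported_inter, chains]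
  congr 1
  ext c
  exact ⟨fun hc => ⟨hc.1.1, hc.2⟩, fun hc => ⟨⟨hc.1, hc.2.trans h⟩, hc.2⟩⟩

/-- The boundary with values in the chains modulo the chains of `B`. -/
noncomputable def boundaryMod (B : Set (V → ℝ)) :
    (Cube V →₀ ℤ) →ₗ[ℤ] ((Cube V →₀ ℤ) ⧸ chainsIn B) :=
  (chainsIn B).mkQ ∘ₗ boundary

/-- This exhibits `relCycles` as chains intersected with a kernel, so that rank–nullity applies. -/
theorem ker_boundaryMod (B : Set (V → ℝ)) :
    (boundaryMod B).ker = (chainsIn B).comap boundary := by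
  rw [boundaryMod, LinearMap.ker_comp, Submodule.ker_mkQ]

theorem relBoundaries_le_chains (b : ℕ) {A B : Set (V → ℝ)} (h : B ⊆ A) :
    relBoundaries b A B ≤ chains b A := by
  refine sup_le ?_ (chains_mono b h)
  rintro _ ⟨x, hx, rfl⟩
  exact boundary_mem_chains hx

theorem relBoundaries_le_relCycles (b : ℕ) {A B : Set (V → ℝ)} (h : B ⊆ A) :
    relBoundaries b A B ≤ relCycles b A B := by
  refine le_inf (relBoundaries_le_chains b h) (sup_le ?_ ?_)
  · rintro _ ⟨x, _, rfl⟩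
    simp [boundary_boundary]
  · exact fun x hx => boundary_mem_chainsIn (chains_le_chainsIn b B hx)

/-- The summand `chains b B` dies in the quotient, leaving the image of the reduced differential
from degree `b + 1`. -/
theorem map_mkQ_relBoundaries (b : ℕ) (A B : Set (V → ℝ)) :
    (relBoundaries b A B).map (chainsIn B).mkQ = (chains (b + 1) A).map (boundaryMod B) := by
  have h0 : (chains b B).map (chainsIn B).mkQ = ⊥ := by
    rw [← LinearMap.le_ker_iff_map, Submodule.ker_mkQ]
    exact chains_le_chainsIn b B
  rw [relBoundaries, Submodule.map_sup, h0, sup_bot_eq, boundaryMod, Submodule.map_comp]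

theorem relBoundaries_inf_chainsIn (b : ℕ) {A B : Set (V → ℝ)} (h : B ⊆ A) :
    relBoundaries b A B ⊓ chainsIn B = chains b B := by
  refine le_antisymm ?_ (le_inf le_sup_right (chains_le_chainsIn b B))
  rw [← chains_inf_chainsIn b h]
  exact inf_le_inf_right _ (relBoundaries_le_chains b h)

theorem finite_chains {b : ℕ} {A : Set (V → ℝ)}
    (hA : {c : Cube V | c.2.card = b ∧ c.toSet ⊆ A}.Finite) : Module.Finite ℤ (chains b A) := by
  have := hA.to_subtype
  exact Module.Finite.equiv
    (Finsupp.supportedEquivFinsupp (M := ℤ) (R := ℤ) {c : Cube V | c.2.card = b ∧ c.toSet ⊆ A}).symm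

theorem finrank_chains {b : ℕ} {A : Set (V → ℝ)}
    (hA : {c : Cube V | c.2.card = b ∧ c.toSet ⊆ A}.Finite) :
    Module.finrank ℤ (chains b A) = {c : Cube V | c.2.card = b ∧ c.toSet ⊆ A}.ncard := by
  have := hA.fintype
  have e := (Finsupp.supportedEquivFinsupp (M := ℤ) (R := ℤ)
    {c : Cube V | c.2.card = b ∧ c.toSet ⊆ A}).finrank_eq
  rw [Module.finrank_finsupp_self, ← Nat.card_eq_fintype_card, Nat.card_coe_set_eq] at e
  exact e

theorem finite_relHomology {b : ℕ} {A : Set (V → ℝ)} (B : Set (V → ℝ))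
    (hA : {c : Cube V | c.2.card = b ∧ c.toSet ⊆ A}.Finite) :
    Module.Finite ℤ (RelHomology b A B) := by
  have := finite_chains hA
  have := isNoetherian_of_le (s := relCycles b A B) (t := chains b A) inf_le_left
  infer_instance

/-- The rank of a relative homology group in terms of the numbers of relative cells and the ranks
of the relative boundary operators. -/
theorem finrank_relHomology {b : ℕ} {A B : Set (V → ℝ)} (hBA : B ⊆ A)
    (hA : {c : Cube V | c.2.card = b ∧ c.toSet ⊆ A}.Finite) :
    (Module.finrank ℤ (RelHomology b A B) : ℤ) =
      {c : Cube V | c.2.card = b ∧ c.toSet ⊆ A ∧ ¬ c.toSet ⊆ B}.ncard -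
        Module.finrank ℤ ((chains b A).map (boundaryMod B)) -
        Module.finrank ℤ ((chains (b + 1) A).map (boundaryMod B)) := by
  have := finite_chains hA
  have := isNoetherian_of_le (s := relCycles b A B) (t := chains b A) inf_le_left
  have := isNoetherian_of_le (relBoundaries_le_chains b hBA)
  have hB : {c : Cube V | c.2.card = b ∧ c.toSet ⊆ B} ⊆ {c | c.2.card = b ∧ c.toSet ⊆ A} :=
    fun c hc => ⟨hc.1, hc.2.trans hBA⟩
  -- `h1` yields the rank of the relative cycles, `h2` that of the relative boundaries, and `h3`
  -- that of their quotient; the cells of `B` enter through `h2` and are subtracted.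
  have h1 := finrank_map_add_finrank_inf_ker (boundaryMod B) (chains b A)
  have h2 := finrank_map_add_finrank_inf_ker (chainsIn B).mkQ (relBoundaries b A B)
  have h3 : Module.finrank ℤ (RelHomology b A B) + _ = _ :=
    finrank_quotient_comap_subtype (relBoundaries_le_relCycles b hBA)
  rw [ker_boundaryMod, finrank_chains hA] at h1
  rw [Submodule.ker_mkQ, relBoundaries_inf_chainsIn b hBA, map_mkQ_relBoundaries,
    finrank_chains (hA.subset hB)] at h2
  have h4 := Set.ncard_sdiff_add_ncard_of_subset hB hA
  have h5 : {c : Cube V | c.2.card = b ∧ c.toSet ⊆ A} \ {c | c.2.card = b ∧ c.toSet ⊆ B} =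
      {c : Cube V | c.2.card = b ∧ c.toSet ⊆ A ∧ ¬ c.toSet ⊆ B} := by
    ext c; simp only [Set.mem_sdiff, Set.mem_ofPred_eq]; tauto
  rw [h5] at h4
  change _ + Module.finrank ℤ (relCycles b A B) = _ at h1
  omega

theorem map_boundaryMod_chains_zero (A B : Set (V → ℝ)) :
    (chains 0 A).map (boundaryMod B) = ⊥ := by
  rw [← LinearMap.le_ker_iff_map]
  intro x hx
  have : boundary x = 0 := by
    rw [boundary, Finsupp.linearCombination_apply]
    refine Finset.sum_eq_zero fun c hc => ?_
    have hc0 : c.2 = ∅ := Finset.card_eq_zero.mp ((Finsupp.mem_supported ℤ x).mp hx hc).1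
    simp [cubeBoundary, hc0]
  simp [boundaryMod, this]

theorem sum_range_alternating (f : ℕ → ℤ) (N : ℕ) :
    ∑ b ∈ Finset.range N, (-1) ^ b * (f b + f (b + 1)) = f 0 - (-1) ^ N * f N := by
  induction N with
  | zero => simp
  | succ N ih => rw [Finset.sum_range_succ, ih, pow_succ]; ring

/-- The Euler characteristic of a pair of finite cubical complexes is the alternating sum of the
numbers of relative cells. -/
theorem sum_neg_one_pow_finrank_relHomology [Fintype V] {A B : Set (V → ℝ)} (hBA : B ⊆ A)
    (hA : {c : Cube V | c.toSet ⊆ A}.Finite) (T : Finset (Cube V))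
    (hT : ∀ c : Cube V, c ∈ T ↔ c.toSet ⊆ A ∧ ¬ c.toSet ⊆ B) :
    ∑ b ∈ Finset.range (Fintype.card V + 1),
      (-1 : ℤ) ^ b * Module.finrank ℤ (RelHomology b A B) = ∑ c ∈ T, (-1 : ℤ) ^ c.2.card := by
  have hAb : ∀ b, {c : Cube V | c.2.card = b ∧ c.toSet ⊆ A}.Finite :=
    fun b => hA.subset fun c hc => hc.2
  have hTb : ∀ b, {c : Cube V | c.2.card = b ∧ c.toSet ⊆ A ∧ ¬ c.toSet ⊆ B}.ncard =
      (T.filter fun c => c.2.card = b).card := by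
    intro b
    rw [← Set.ncard_coe_finset]
    congr 1
    ext c
    simp [hT, and_comm]
  have htop : chains (Fintype.card V + 1) A = ⊥ := by
    refine chains_eq_bot fun c hc _ => ?_
    have := Finset.card_le_univ c.2
    omega
  -- The rank of each differential occurs in two adjacent degrees with opposite signs. The end terms
  -- vanish, because the differentials out of degrees `0` and `|V| + 1` are zero.
  have halt := sum_range_alternating
    (fun b => (Module.finrank ℤ ((chains b A).map (boundaryMod B)) : ℤ)) (Fintype.card V + 1)
  rw [map_boundaryMod_chains_zero, htop, Submodule.map_bot] at halt
  simp only [finrank_bot, Nat.cast_zero, mul_zero, sub_zero] at halt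
  have hsum : ∑ c ∈ T, (-1 : ℤ) ^ c.2.card = ∑ b ∈ Finset.range (Fintype.card V + 1),
      (-1 : ℤ) ^ b * (T.filter fun c => c.2.card = b).card := by
    rw [← Finset.sum_fiberwise_of_maps_to (t := Finset.range (Fintype.card V + 1))
      (g := fun c : Cube V => c.2.card)
      fun c _ => Finset.mem_range.mpr (Nat.lt_succ_of_le (Finset.card_le_univ c.2))]
    refine Finset.sum_congr rfl fun b _ => ?_
    rw [Finset.sum_congr rfl (g := fun _ => (-1 : ℤ) ^ b)
      fun c hc => by rw [(Finset.mem_filter.mp hc).2], Finset.sum_const, nsmul_eq_mul, mul_comm]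
  rw [hsum, ← sub_eq_zero, ← Finset.sum_sub_distrib, ← neg_eq_zero, ← Finset.sum_neg_distrib]
  refine Eq.trans (Finset.sum_congr rfl fun b _ => ?_) halt
  rw [finrank_relHomology hBA (hAb b), hTb]
  ring

end Euler

end PlumbingLattice
namespace PlumbingLattice

/-! ### Cubes in weighted cubical spaces -/

section Geometry

variable {V : Type*} [LinearOrder V]

/-- A cube contained in a union of cubes is a face of one of them. -/
theorem exists_face_of_toSet_subset {c : Cube V} {T : Set (Cube V)}
    (h : c.toSet ⊆ ⋃ c' ∈ T, c'.toSet) :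
    ∃ c' ∈ T, ∀ i, c'.1 i ≤ c.1 i ∧ c.1 i + indVec c.2 i ≤ c'.1 i + indVec c'.2 i := by
  -- The centre of `c` lies in some `c'`. Its coordinates are half-integral exactly in the
  -- directions of `c`, so `c'` must extend in each of those; doubling the inequalities makes them
  -- integral.
  have hx : (fun i => (c.1 i : ℝ) + (indVec c.2 i : ℝ) / 2) ∈ c.toSet := by
    intro i
    have : (0 : ℝ) ≤ indVec c.2 i := by exact_mod_cast indVec_nonneg c.2 i
    constructor <;> dsimp only <;> linarith
  obtain ⟨c', hc', hx'⟩ := Set.mem_iUnion₂.mp (h hx)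
  refine ⟨c', hc', fun i => ?_⟩
  obtain ⟨h1, h2⟩ := hx' i
  dsimp only at h1 h2
  have h3 : 2 * c'.1 i ≤ 2 * c.1 i + indVec c.2 i := by
    have : (2 : ℝ) * c'.1 i ≤ 2 * c.1 i + indVec c.2 i := by linarith
    exact_mod_cast this
  have h4 : 2 * c.1 i + indVec c.2 i ≤ 2 * (c'.1 i + indVec c'.2 i) := by
    have : (2 : ℝ) * c.1 i + indVec c.2 i ≤ 2 * (c'.1 i + indVec c'.2 i) := by linarith
    exact_mod_cast this
  revert h3 h4
  unfold indVec
  split_ifs <;> omega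

theorem intCast_mem_toSet (c : Cube V) : (fun i => (c.1 i : ℝ)) ∈ c.toSet := by
  intro i
  have : (0 : ℝ) ≤ indVec c.2 i := by exact_mod_cast indVec_nonneg c.2 i
  constructor <;> dsimp only <;> linarith

namespace ResolutionGraph

theorem toQ_single (i : V) : toQ (Pi.single i 1) = E i := by
  ext j
  by_cases hj : j = i
  · subst hj; simp [toQ, E]
  · simp [toQ, E, hj]

variable [Fintype V] (Γ : ResolutionGraph V)

theorem chi_le_weight (h : Γ.H) {c : Cube V} {J : Finset V} (hJ : J ⊆ c.2) :
    Γ.chi h (c.1 + indVec J) ≤ Γ.weight h c :=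
  Finset.le_sup' (fun J => Γ.chi h (c.1 + indVec J)) (Finset.mem_powerset.mpr hJ)

/-- A lattice point of a closed unit cube is a vertex, namely the one given by the directions in
which it exceeds the base point. -/
theorem chi_le_weight_of_mem (h : Γ.H) {c : Cube V} {p : V → ℤ}
    (hp : ∀ i, c.1 i ≤ p i ∧ p i ≤ c.1 i + indVec c.2 i) : Γ.chi h p ≤ Γ.weight h c := by
  have e : p = c.1 + indVec (c.2.filter fun i => c.1 i < p i) := by
    ext i
    obtain ⟨h1, h2⟩ := hp i
    simp only [indVec, Pi.add_apply, Finset.mem_filter] at h2 ⊢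
    by_cases hi : i ∈ c.2 <;> by_cases hlt : c.1 i < p i <;> simp [hi, hlt] at h2 ⊢ <;> omega
  rw [e]
  exact Γ.chi_le_weight h (Finset.filter_subset _ _)

theorem chi_base_le_weight (h : Γ.H) (c : Cube V) : Γ.chi h c.1 ≤ Γ.weight h c :=
  Γ.chi_le_weight_of_mem h fun i => ⟨le_rfl, by have := indVec_nonneg c.2 i; omega⟩

theorem weight_le_weight (h : Γ.H) {c c' : Cube V}
    (hf : ∀ i, c'.1 i ≤ c.1 i ∧ c.1 i + indVec c.2 i ≤ c'.1 i + indVec c'.2 i) :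
    Γ.weight h c ≤ Γ.weight h c' := by
  refine Finset.sup'_le _ _ fun J hJ => Γ.chi_le_weight_of_mem h fun i => ?_
  have h1 := hf i
  have h2 := indVec_nonneg J i
  have h3 : indVec J i ≤ indVec c.2 i := by
    have hi : i ∈ J → i ∈ c.2 := fun hi => Finset.mem_powerset.mp hJ hi
    unfold indVec
    split_ifs <;> simp_all
  simp only [Pi.add_apply]
  omega

/-- A cube inside the union is a face of one of the cubes, and passing to a face cannot increase the
weight; hence the bound holds for the cube itself. -/
theorem toSet_subset_S_iff (h : Γ.H) (n : ℤ) (c : Cube V) :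
    c.toSet ⊆ Γ.S h n ↔ Γ.weight h c ≤ n ∧ 0 ≤ c.1 := by
  constructor
  · intro hc
    refine ⟨?_, fun i => ?_⟩
    · obtain ⟨c', hc', hf⟩ := exists_face_of_toSet_subset (hc.trans Set.inter_subset_left)
      exact (Γ.weight_le_weight h hf).trans hc'
    · have := (hc (intCast_mem_toSet c)).2 i
      dsimp only at this
      exact_mod_cast this
  · rintro ⟨hw, h0⟩ x hx
    refine ⟨Set.mem_biUnion (show c ∈ {c : Cube V | Γ.weight h c ≤ n} from hw) hx, fun i => ?_⟩
    refine le_trans ?_ (hx i).1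
    exact_mod_cast h0 i

theorem toSet_subset_Xmulti_iff (s : V → ℚ) (lt : Γ.supp s → ℕ) (c : Cube V) :
    c.toSet ⊆ Γ.Xmulti s lt ↔
      (∀ i : Γ.supp s, (lt i : ℤ) ≤ c.1 i) ∧ ∀ i ∉ Γ.supp s, 0 ≤ c.1 i := by
  constructor
  · intro hc
    obtain ⟨h1, h2⟩ := hc (intCast_mem_toSet c)
    dsimp only at h1 h2
    exact ⟨fun i => by exact_mod_cast h1 i, fun i hi => by exact_mod_cast h2 i hi⟩
  · rintro ⟨h1, h2⟩ x hx
    refine ⟨fun i => le_trans ?_ (hx i).1, fun i hi => le_trans ?_ (hx i).1⟩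
    · exact_mod_cast h1 i
    · exact_mod_cast h2 i hi

theorem form_toQ_eq_sum (s : V → ℚ) (l : V → ℤ) :
    Γ.form s (toQ l) = ∑ i, (l i : ℚ) * Γ.form s (E i) := Γ.form_eq_sum s (toQ l)

/-- The base point of a face dominates that of the cube, and `(s, ·)` is nonincreasing because `s`
lies in the Lipman cone. -/
theorem toSet_subset_X_iff {s : V → ℚ} (hs : s ∈ Γ.lipmanCone) (d : ℚ) (c : Cube V) :
    c.toSet ⊆ Γ.X s d ↔ 0 ≤ c.1 ∧ Γ.form s (toQ c.1) ≤ -d := by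
  constructor
  · intro hc
    obtain ⟨c', ⟨h0, hd⟩, hf⟩ := exists_face_of_toSet_subset hc
    refine ⟨fun i => (h0 i).trans (hf i).1, le_trans ?_ hd⟩
    rw [form_toQ_eq_sum, form_toQ_eq_sum]
    refine Finset.sum_le_sum fun i _ => mul_le_mul_of_nonpos_right ?_ (hs.2 i)
    exact_mod_cast (hf i).1
  · exact fun hc => Set.subset_biUnion_of_mem (u := Cube.toSet) hc

theorem exists_form_E_eq_intCast {x : V → ℚ} (hx : x ∈ Γ.dualLattice) (i : V) :
    ∃ m : ℤ, Γ.form x (E i) = m := by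
  rw [← toQ_single]; exact hx _

theorem one_le_neg_form_E {x : V → ℚ} (hx : x ∈ Γ.dualLattice) {i : V}
    (hi : Γ.form x (E i) < 0) : 1 ≤ -Γ.form x (E i) := by
  obtain ⟨m, hm⟩ := Γ.exists_form_E_eq_intCast hx i
  rw [hm] at hi ⊢
  have : m < 0 := by exact_mod_cast hi
  have : 1 ≤ -m := by omega
  exact_mod_cast this

theorem form_E_eq_zero_of_notMem_supp {s : V → ℚ} (hs : s ∈ Γ.lipmanCone) {i : V}
    (hi : i ∉ Γ.supp s) : Γ.form s (E i) = 0 :=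
  le_antisymm (hs.2 i) (not_lt.mp hi)

theorem extend_coe (s : V → ℚ) (lt : Γ.supp s → ℕ) (i : Γ.supp s) : Γ.extend s lt i = lt i := by
  simp [extend]

/-- The relative cells of the pair that defines `E1`. -/
theorem relative_cell_iff (h : Γ.H) {s : V → ℚ} (hs : s ∈ Γ.lipmanCone) (lt : Γ.supp s → ℕ)
    (n : ℤ) (c : Cube V) :
    (c.toSet ⊆ Γ.S h n ∩ Γ.Xmulti s lt ∧
      ¬ c.toSet ⊆ Γ.S h n ∩ Γ.Xmulti s lt ∩ Γ.X s (Γ.deg s lt + 1)) ↔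
    Γ.weight h c ≤ n ∧ 0 ≤ c.1 ∧ ∀ i : Γ.supp s, c.1 i = lt i := by
  simp only [Set.subset_inter_iff, toSet_subset_S_iff, toSet_subset_Xmulti_iff,
    Γ.toSet_subset_X_iff hs]
  -- The defect `(s, l) + d(l̃)` is a sum over coordinates to which only the support of `s`
  -- contributes.
  have hdeg : Γ.form s (toQ c.1) + Γ.deg s lt =
      ∑ i, ((c.1 i : ℚ) - Γ.extend s lt i) * Γ.form s (E i) := by
    rw [deg, form_toQ_eq_sum, form_toQ_eq_sum, ← sub_eq_add_neg, ← Finset.sum_sub_distrib]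
    exact Finset.sum_congr rfl fun i _ => by ring
  constructor
  · rintro ⟨⟨⟨hw, h0⟩, hge, -⟩, hnot⟩
    refine ⟨hw, h0, fun i => ?_⟩
    by_contra hne
    have hgt : (lt i : ℤ) + 1 ≤ c.1 i := by have := hge i; omega
    refine hnot ⟨⟨⟨hw, h0⟩, hge, fun i _ => h0 i⟩, h0, ?_⟩
    -- All terms are nonpositive, and by integrality the term at `i` is at most `-1`: exactly the
    -- step from `-d(l̃)` to `-d(l̃) - 1`.
    have hsum : ∑ j, ((c.1 j : ℚ) - Γ.extend s lt j) * Γ.form s (E j) ≤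
        ((c.1 i : ℚ) - Γ.extend s lt i) * Γ.form s (E i) := by
      rw [← Finset.sum_erase_add _ _ (Finset.mem_univ (i : V))]
      refine add_le_of_nonpos_left (Finset.sum_nonpos fun j _ => ?_)
      by_cases hj : j ∈ Γ.supp s
      · refine mul_nonpos_of_nonneg_of_nonpos ?_ (hs.2 j)
        have h1 := hge ⟨j, hj⟩
        rw [← Γ.extend_coe s lt ⟨j, hj⟩] at h1
        have h2 : (Γ.extend s lt j : ℚ) ≤ c.1 j := by exact_mod_cast h1
        linarith
      · rw [Γ.form_E_eq_zero_of_notMem_supp hs hj, mul_zero]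
    have h1 : (1 : ℚ) ≤ (c.1 i : ℚ) - Γ.extend s lt i := by
      rw [extend_coe]
      have : ((lt i : ℤ) : ℚ) + 1 ≤ c.1 i := by exact_mod_cast hgt
      linarith
    have h2 := Γ.one_le_neg_form_E hs.1 i.2
    have h3 := one_le_mul_of_one_le_of_one_le h1 h2
    linarith
  · rintro ⟨hw, h0, heq⟩
    refine ⟨⟨⟨hw, h0⟩, fun i => (heq i).ge, fun i _ => h0 i⟩, fun hnot => ?_⟩
    have hz : ∑ i, ((c.1 i : ℚ) - Γ.extend s lt i) * Γ.form s (E i) = 0 := by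
      refine Finset.sum_eq_zero fun i _ => ?_
      by_cases hi : i ∈ Γ.supp s
      · have := Γ.extend_coe s lt ⟨i, hi⟩
        have h1 := heq ⟨i, hi⟩
        dsimp only at this h1
        rw [this, h1, sub_self, zero_mul]
      · rw [Γ.form_E_eq_zero_of_notMem_supp hs hi, mul_zero]
    have := hnot.2.2
    linarith

/-! ### Finiteness of the sublevel sets of the weight function -/

/-- Cauchy–Schwarz: the polynomial `-(x + ty, x + ty)` in `t` is nonnegative, so its discriminant is
nonpositive. -/
theorem form_sq_le (x y : V → ℚ) : Γ.form x y ^ 2 ≤ Γ.form x x * Γ.form y y := by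
  have h := discrim_le_zero (a := -Γ.form y y) (b := -(2 * Γ.form x y)) (c := -Γ.form x x)
    fun t => by
      have := Γ.form_self_nonpos (x + t • y)
      simp only [form_add_left, form_add_right, form_smul_left, form_smul_right] at this
      rw [Γ.form_comm y x] at this
      linarith
  rw [discrim] at h
  linarith

theorem exists_form_eq_coord (i : V) : ∃ y : V → ℚ, ∀ x, Γ.form y x = x i := by
  refine ⟨Γ.mat⁻¹.mulVec (E i), fun x => ?_⟩
  rw [form_eq_sum]
  simp only [form_E, Matrix.mulVec_mulVec, Matrix.mul_nonsing_inv _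
      ((Matrix.isUnit_iff_isUnit_det _).mp Γ.isUnit_mat), Matrix.one_mulVec]
  simp [E, Pi.single_apply]

/-- Completing the square gives `-(l + k/2, l + k/2) = 2χ_h(l) - (k, k)/4`. Cauchy–Schwarz against
the vectors dual to the coordinates then bounds every `l i`. -/
theorem finite_setOf_chi_le (h : Γ.H) (n : ℤ) : {l : V → ℤ | Γ.chi h l ≤ n}.Finite := by
  choose y hy using Γ.exists_form_eq_coord
  set k := Γ.kChar h
  have hbound : ∀ i, ∃ N : ℕ, ∀ l : V → ℤ, Γ.chi h l ≤ n → |l i| ≤ N := by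
    intro i
    set C := -Γ.form (y i) (y i) with hC
    set R := 2 * (n : ℚ) - Γ.form k k / 4 with hR
    obtain ⟨N, hN⟩ := exists_nat_ge (C * R + 1 + |k i| / 2)
    refine ⟨N, fun l hl => ?_⟩
    have hl' : Γ.chiQ h l ≤ n := by rw [← chi_eq]; exact_mod_cast hl
    have h1 := Γ.form_sq_le (y i) (toQ l + (1 / 2 : ℚ) • k)
    have h2 : -Γ.form (toQ l + (1 / 2 : ℚ) • k) (toQ l + (1 / 2 : ℚ) • k) ≤ R := by
      rw [chiQ, form_add_right] at hl'
      simp only [form_add_left, form_add_right, form_smul_left, form_smul_right]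
      rw [Γ.form_comm k (toQ l)]
      linarith
    have hC0 : 0 ≤ C := by have := Γ.form_self_nonpos (y i); linarith
    rw [hy] at h1
    simp only [Pi.add_apply, Pi.smul_apply, toQ, smul_eq_mul] at h1
    have h3 : ((l i : ℚ) + 1 / 2 * k i) ^ 2 ≤ C * R := by
      refine h1.trans (le_trans (le_of_eq ?_) (mul_le_mul_of_nonneg_left h2 hC0))
      rw [hC]; ring
    -- Square roots are avoided by `|x| ≤ x² + 1`, which follows from `(|x| - 1/2)² ≥ 0`.
    have h4 : |(l i : ℚ) + 1 / 2 * k i| ≤ C * R + 1 := by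
      rw [← sq_abs] at h3
      nlinarith [sq_nonneg (|(l i : ℚ) + 1 / 2 * k i| - 1 / 2)]
    have h5 : |(l i : ℚ)| ≤ N := by
      have := abs_sub ((l i : ℚ) + 1 / 2 * k i) (1 / 2 * k i)
      rw [add_sub_cancel_right, abs_mul, abs_of_pos (by norm_num : (0 : ℚ) < 1 / 2)] at this
      linarith
    exact_mod_cast h5
  choose N hN using hbound
  refine (Set.Finite.pi' fun i => Set.finite_Icc (-(N i : ℤ)) (N i)).subset fun l hl i => ?_
  exact abs_le.mp (hN i l hl)

theorem finite_setOf_weight_le (h : Γ.H) (n : ℤ) : {c : Cube V | Γ.weight h c ≤ n}.Finite :=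
  ((Γ.finite_setOf_chi_le h n).prod (Set.finite_univ (α := Finset V))).subset fun c hc =>
    ⟨(Γ.chi_base_le_weight h c).trans hc, Set.mem_univ _⟩

theorem finite_setOf_toSet_subset_S (h : Γ.H) (n : ℤ) (A : Set (V → ℝ)) :
    {c : Cube V | c.toSet ⊆ Γ.S h n ∩ A}.Finite :=
  (Γ.finite_setOf_weight_le h n).subset fun c hc =>
    ((Γ.toSet_subset_S_iff h n c).mp (Set.subset_inter_iff.mp hc).1).1

end ResolutionGraph
end Geometry
end PlumbingLattice
namespace PlumbingLattice

section Series

/-! ### The coefficients of the motivic Poincaré series -/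

theorem coeff_geomSeries (k : ℤ) : geomSeries.coeff k = if 0 ≤ k then 1 else 0 := by
  rw [geomSeries, PowerSeries.coeff_coe]
  by_cases hk : 0 ≤ k
  · rw [if_neg (not_lt.mpr hk), if_pos hk, PowerSeries.coeff_mk]
  · rw [if_pos (not_le.mp hk), if_neg hk]

theorem coeff_neg_one_pow_mul (k : ℕ) (x : LaurentSeries ℤ) (n : ℤ) :
    ((-1) ^ k * x).coeff n = (-1) ^ k * x.coeff n := by
  rcases neg_one_pow_eq_or (LaurentSeries ℤ) k with h | h <;>
    rcases Nat.even_or_odd k with hk | hk <;> simp [hk.neg_one_pow]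

theorem toQ_injective {V : Type*} : Function.Injective (toQ : (V → ℤ) → V → ℚ) := by
  intro l l' hl
  ext i
  have := congrFun hl i
  simpa [toQ] using this

theorem toQ_add {V : Type*} (l l' : V → ℤ) : toQ (l + l') = toQ l + toQ l' := by
  ext i; simp [toQ]

variable {V : Type*} [LinearOrder V]

theorem toQ_indVec_singleton (i : V) : toQ (indVec {i}) = ResolutionGraph.E i := by
  rw [← ResolutionGraph.toQ_single]
  congr 1
  ext j
  simp [indVec, Pi.single_apply]

theorem indVec_insert {i : V} {J : Finset V} (hi : i ∉ J) :
    indVec (insert i J) = indVec J + indVec {i} := by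
  ext j
  by_cases hj : j = i
  · subst hj; simp [indVec, hi]
  · simp [indVec, hj]

namespace ResolutionGraph

variable [Fintype V] (Γ : ResolutionGraph V)

theorem sMin_mem (h : Γ.H) : Γ.sMin h ∈ Γ.lipmanClass h := (Γ.sMin_isLeast h).1

/-- By adjunction `(E_i, E_i + k_h) = -2 + 2(s_h, E_i)`. This ties the growth of `χ_h` to the
inequalities that define the Lipman cone. -/
theorem chi_add_indVec_singleton (h : Γ.H) (l : V → ℤ) (i : V) :
    (Γ.chi h (l + indVec {i}) : ℚ) = Γ.chi h l + 1 - Γ.form (toQ l + Γ.sMin h) (E i) := by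
  have hk : Γ.form (E i) (Γ.kChar h) =
      -(Γ.form (E i) (E i) + 2) + 2 * Γ.form (Γ.sMin h) (E i) := by
    rw [form_comm, kChar, form_add_left, form_neg_left, adjunction, form_smul_left]
  rw [chi_eq, chi_eq, chiQ, chiQ, toQ_add, toQ_indVec_singleton]
  simp only [form_add_left, form_add_right]
  rw [hk, Γ.form_comm (E i) (toQ l)]
  ring

theorem mat_nonneg_of_ne {i j : V} (hij : i ≠ j) : 0 ≤ Γ.mat i j := by
  simp only [mat, intersectionMatrix, Matrix.of_apply, hij, if_false]
  split_ifs <;> norm_num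

theorem form_indVec_E_nonneg {J : Finset V} {i : V} (hi : i ∉ J) :
    0 ≤ Γ.form (toQ (indVec J)) (E i) := by
  rw [form_E]
  refine Finset.sum_nonneg fun j _ => ?_
  by_cases hij : i = j
  · subst hij
    simp [toQ, indVec_of_notMem hi]
  · refine mul_nonneg (Γ.mat_nonneg_of_ne hij) ?_
    have := indVec_nonneg J j
    simp only [toQ]
    exact_mod_cast this

theorem toQ_add_sMin_mem (h : Γ.H) (l : V → ℤ) : toQ l + Γ.sMin h ∈ Γ.dualLattice :=
  add_mem (Γ.toQ_mem l) (Γ.sMin_mem h).1.1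

theorem one_le_form_E {x : V → ℚ} (hx : x ∈ Γ.dualLattice) {i : V}
    (hi : 0 < Γ.form x (E i)) : 1 ≤ Γ.form x (E i) := by
  have := Γ.one_le_neg_form_E (neg_mem hx) (i := i) (by rw [form_neg_left]; linarith)
  rwa [form_neg_left, neg_neg] at this

/-- If `l + s_h` pairs positively with `E_i`, the weight of a cube at `l` does not change when the
direction `i` is added. -/
theorem weight_insert (h : Γ.H) {l : V → ℤ} {i : V}
    (hi : 0 < Γ.form (toQ l + Γ.sMin h) (E i)) (I : Finset V) :
    Γ.weight h (l, insert i I) = Γ.weight h (l, I) := by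
  refine le_antisymm (Finset.sup'_le _ _ fun J hJ => ?_) (Γ.weight_le_weight h fun j => ?_)
  · have hJ' : J.erase i ⊆ I := by
      rw [Finset.mem_powerset] at hJ
      exact Finset.subset_insert_iff.mp hJ
    refine le_trans ?_ (Γ.chi_le_weight h (c := (l, I)) hJ')
    by_cases hiJ : i ∈ J
    · have h1 := Γ.one_le_form_E (Γ.toQ_add_sMin_mem h l) hi
      have h2 := Γ.form_indVec_E_nonneg (Finset.notMem_erase i J)
      have h3 := Γ.chi_add_indVec_singleton h (l + indVec (J.erase i)) i
      rw [add_assoc l, ← indVec_insert (Finset.notMem_erase i J), Finset.insert_erase hiJ,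
        toQ_add, add_right_comm, form_add_left] at h3
      have : (Γ.chi h (l + indVec J) : ℚ) ≤ Γ.chi h (l + indVec (J.erase i)) := by linarith
      exact_mod_cast this
    · rw [Finset.erase_eq_of_notMem hiJ]
  · refine ⟨le_rfl, ?_⟩
    simp only [indVec, Finset.mem_insert]
    split_ifs <;> simp_all

/-- The terms of `I` and `insert i I` have equal weight and opposite sign. -/
theorem Zmcoeff_eq_zero_of_pos (h : Γ.H) {l : V → ℤ} {i : V}
    (hi : 0 < Γ.form (toQ l + Γ.sMin h) (E i)) : Γ.Zmcoeff h l = 0 := by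
  have huniv : (Finset.univ : Finset (Finset V)) =
      (insert i (Finset.univ.erase i) : Finset V).powerset := by
    rw [Finset.insert_erase (Finset.mem_univ i), Finset.powerset_univ]
  rw [Zmcoeff, huniv, Finset.sum_powerset_insert (Finset.notMem_erase i _),
    ← Finset.sum_add_distrib, Finset.sum_eq_zero, mul_zero]
  intro I hI
  have hiI : i ∉ I := fun hmem => Finset.notMem_erase i _ (Finset.mem_powerset.mp hI hmem)
  rw [Γ.weight_insert h hi I, Finset.card_insert_of_notMem hiI, pow_succ]
  ring

/-- The series `Z^m_h` is supported on the Lipman cone. -/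
theorem mem_lipmanClass_of_Zmcoeff_ne_zero (h : Γ.H) {l : V → ℤ} (hl : Γ.Zmcoeff h l ≠ 0) :
    toQ l + Γ.sMin h ∈ Γ.lipmanClass h := by
  have hmem := Γ.toQ_add_sMin_mem h l
  refine ⟨⟨hmem, fun i => ?_⟩, hmem, ?_⟩
  · by_contra hi
    exact hl (Γ.Zmcoeff_eq_zero_of_pos h (not_le.mp hi))
  · obtain ⟨_, hsL, hsh⟩ := Γ.sMin_mem h
    exact ((Γ.mk_eq_mk_iff hsL hmem).mpr ⟨l, add_comm _ _⟩).symm.trans hsh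

/-- Here the minimality of `s_h` in its class enters; it explains why restricting the spaces to the
positive quadrant loses nothing. -/
theorem nonneg_of_Zmcoeff_ne_zero (h : Γ.H) {l : V → ℤ} (hl : Γ.Zmcoeff h l ≠ 0) : 0 ≤ l := by
  intro i
  have h1 := (Γ.sMin_isLeast h).2 (Γ.mem_lipmanClass_of_Zmcoeff_ne_zero h hl) i
  simp only [Pi.add_apply, toQ] at h1
  have : (0 : ℚ) ≤ l i := by linarith
  exact_mod_cast this

/-- Multiplication by `1/(1-q)` turns counts at weight exactly `n` into counts at weight at most
`n`, matching the sublevel spaces `S_n`. -/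
theorem coeff_Zmcoeff (h : Γ.H) (l : V → ℤ) (n : ℤ) :
    (Γ.Zmcoeff h l).coeff n =
      ∑ I : Finset V, if Γ.weight h (l, I) ≤ n then (-1 : ℤ) ^ I.card else 0 := by
  rw [Zmcoeff, Finset.mul_sum, HahnSeries.coeff_sum]
  refine Finset.sum_congr rfl fun I _ => ?_
  rw [mul_left_comm, coeff_neg_one_pow_mul, HahnSeries.coeff_mul_single, coeff_geomSeries]
  simp only [sub_nonneg, mul_one, mul_ite, mul_zero]

/-! ### Finiteness of the substitution -/

/-- In `(x, E_i) ≤ 0` the neighbours other than `j` contribute nonnegatively and may be dropped. -/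
theorem le_euler_mul_of_adj {x : V → ℚ} (hx : x ∈ Γ.lipmanCone) {i j : V}
    (hij : Γ.graph.Adj i j) : x j ≤ -Γ.euler i * x i := by
  have h0 := hx.2 i
  rw [form_E, Matrix.mulVec, dotProduct, ← Finset.sum_erase_add _ _ (Finset.mem_univ i)] at h0
  have h1 : Γ.mat i j * x j ≤ ∑ k ∈ Finset.univ.erase i, Γ.mat i k * x k :=
    Finset.single_le_sum (f := fun k => Γ.mat i k * x k)
      (fun k hk => mul_nonneg (Γ.mat_nonneg_of_ne (Finset.ne_of_mem_erase hk).symm)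
        (Γ.lipmanCone_nonneg hx k))
      (Finset.mem_erase.mpr ⟨hij.ne', Finset.mem_univ j⟩)
  have h2 : Γ.mat i j = 1 := by simp [mat, intersectionMatrix, hij.ne, hij]
  have h3 : Γ.mat i i = Γ.euler i := by simp [mat, intersectionMatrix]
  rw [h2, one_mul] at h1
  rw [h3] at h0
  linarith

/-- On a subset of the Lipman cone, a bound for one coordinate gives bounds for all of them. -/
theorem exists_coord_le {T : Set (V → ℚ)} (hT : T ⊆ Γ.lipmanCone) {i : V} {C : ℚ}
    (hC : ∀ x ∈ T, x i ≤ C) (j : V) : ∃ D : ℚ, ∀ x ∈ T, x j ≤ D := by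
  -- Connectedness of the tree lets the bound spread from `i` to `j` one edge at a time.
  have hr := (SimpleGraph.reachable_iff_reflTransGen i j).mp (Γ.isTree.connected.preconnected i j)
  induction hr with
  | refl => exact ⟨C, hC⟩
  | @tail k m _ hkm ih =>
    obtain ⟨D, hD⟩ := ih
    refine ⟨|(Γ.euler k : ℚ)| * D, fun x hx => ?_⟩
    refine (Γ.le_euler_mul_of_adj (hT hx) hkm).trans ?_
    have h0 := Γ.lipmanCone_nonneg (hT hx) k
    exact (mul_le_mul_of_nonneg_right (neg_le_abs _) h0).trans
      (mul_le_mul_of_nonneg_left (hD x hx) (abs_nonneg _))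

theorem supp_nonempty {s : V → ℚ} (hs : s ∈ Γ.lipmanCone) (hs0 : s ≠ 0) : (Γ.supp s).Nonempty := by
  by_contra hemp
  rw [Set.not_nonempty_iff_eq_empty] at hemp
  have h0 : Γ.form s s = 0 := by
    rw [form_eq_sum]
    refine Finset.sum_eq_zero fun i _ => ?_
    rw [Γ.form_E_eq_zero_of_notMem_supp hs (by simp [hemp]), mul_zero]
  exact (Γ.negDef s hs0).ne h0

theorem mult_pos (s : V → ℚ) (i : Γ.supp s) : 0 < Γ.mult s i := neg_pos.mpr i.2

/-- The exponent fixes the coordinate at some vertex of the nonempty support; the Lipman cone turns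
this into upper bounds everywhere, and `l ≥ 0` supplies the lower ones. -/
theorem finite_fibre {s : V → ℚ} (hs : s ∈ Γ.lipmanCone) (hs0 : s ≠ 0) (h : Γ.H)
    (c : Γ.supp s → ℚ) : {l : V → ℤ | Γ.substExponent s (toQ l) = c ∧ Γ.Zmcoeff h l ≠ 0}.Finite := by
  obtain ⟨i, hi⟩ := Γ.supp_nonempty hs hs0
  set T : Set (V → ℤ) := {l | Γ.substExponent s (toQ l) = c ∧ Γ.Zmcoeff h l ≠ 0}
  have hT : (fun l => toQ l + Γ.sMin h) '' T ⊆ Γ.lipmanCone := by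
    rintro _ ⟨l, hl, rfl⟩
    exact (Γ.mem_lipmanClass_of_Zmcoeff_ne_zero h hl.2).1
  have hC : ∀ x ∈ (fun l => toQ l + Γ.sMin h) '' T,
      x i ≤ c ⟨i, hi⟩ / Γ.mult s i + Γ.sMin h i := by
    rintro _ ⟨l, hl, rfl⟩
    have h1 := congrFun hl.1 ⟨i, hi⟩
    simp only [substExponent] at h1
    have h2 := Γ.mult_pos s ⟨i, hi⟩
    rw [← h1, mul_div_cancel_left₀ _ h2.ne']
    rfl
  choose D hD using Γ.exists_coord_le hT hC
  refine (Set.Finite.pi' fun j => Set.finite_Icc (0 : ℤ) ⌊D j⌋).subset fun l hl j => ?_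
  refine ⟨Γ.nonneg_of_Zmcoeff_ne_zero h hl.2 j, Int.le_floor.mpr ?_⟩
  have h1 := hD j _ ⟨l, hl, rfl⟩
  have h2 := Γ.lipmanCone_nonneg (Γ.sMin_mem h).1 j
  simp only [Pi.add_apply, toQ] at h1
  linarith

/-! ### The substituted series as finite sums over lattice points. -/

theorem mulMonomial_Zm_toQ (h : Γ.H) (l : V → ℤ) :
    mulMonomial (Γ.Zm h) (-Γ.sMin h) (toQ l) = Γ.Zmcoeff h l := by
  have e : {k : V → ℤ | toQ k + Γ.sMin h = toQ l - -Γ.sMin h} = {l} := by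
    ext k
    simp [toQ_injective.eq_iff]
  rw [mulMonomial, Zm, formalSum, e, finsum_mem_singleton]

theorem exists_toQ_of_mulMonomial_Zm_ne_zero (h : Γ.H) {a : V → ℚ}
    (ha : mulMonomial (Γ.Zm h) (-Γ.sMin h) a ≠ 0) : ∃ l, toQ l = a := by
  by_contra hne
  push Not at hne
  apply ha
  have e : {k : V → ℤ | toQ k + Γ.sMin h = a - -Γ.sMin h} = ∅ := by
    ext k
    simp [hne k]
  rw [mulMonomial, Zm, formalSum, e, finsum_mem_empty]

theorem substitutable_mulMonomial_Zm {s : V → ℚ} (hs : s ∈ Γ.lipmanCone) (hs0 : s ≠ 0)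
    (h : Γ.H) : Substitutable (Γ.substExponent s) (mulMonomial (Γ.Zm h) (-Γ.sMin h)) := by
  refine fun c => ((Γ.finite_fibre hs hs0 h c).image toQ).subset ?_
  rintro a ⟨hac, ha⟩
  obtain ⟨l, rfl⟩ := Γ.exists_toQ_of_mulMonomial_Zm_ne_zero h ha
  rw [mulMonomial_Zm_toQ] at ha
  exact ⟨l, ⟨hac, ha⟩, rfl⟩

theorem substMonomials_mulMonomial_Zm {s : V → ℚ} (hs : s ∈ Γ.lipmanCone) (hs0 : s ≠ 0)
    (h : Γ.H) (c : Γ.supp s → ℚ) :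
    substMonomials (Γ.substExponent s) (mulMonomial (Γ.Zm h) (-Γ.sMin h)) c =
      ∑ l ∈ (Γ.finite_fibre hs hs0 h c).toFinset, Γ.Zmcoeff h l := by
  have e : ∑ l ∈ (Γ.finite_fibre hs hs0 h c).toFinset, Γ.Zmcoeff h l =
      ∑ a ∈ (Γ.finite_fibre hs hs0 h c).toFinset.map ⟨toQ, toQ_injective⟩,
        mulMonomial (Γ.Zm h) (-Γ.sMin h) a := by
    rw [Finset.sum_map]
    exact Finset.sum_congr rfl fun l _ => (Γ.mulMonomial_Zm_toQ h l).symm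
  rw [e, substMonomials, formalSum]
  refine finsum_mem_eq_sum_of_inter_support_eq _ ?_
  ext a
  simp only [Set.mem_inter_iff, Set.mem_ofPred_eq, Function.mem_support, Finset.coe_map,
    Function.Embedding.coeFn_mk, Set.Finite.coe_toFinset, Set.mem_image]
  constructor
  · rintro ⟨hac, ha⟩
    obtain ⟨l, rfl⟩ := Γ.exists_toQ_of_mulMonomial_Zm_ne_zero h ha
    exact ⟨⟨l, ⟨hac, by rwa [mulMonomial_Zm_toQ] at ha⟩, rfl⟩, ha⟩
  · rintro ⟨⟨l, ⟨hac, _⟩, rfl⟩, ha⟩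
    exact ⟨hac, ha⟩

/-! ### The Euler characteristic of the first page -/

/-- The exponent of `T` attached to a lattice point over `Supp(s)`. -/
theorem substExponent_toQ_eq_iff (s : V → ℚ) (l : V → ℤ) (lt : Γ.supp s → ℕ) :
    Γ.substExponent s (toQ l) = (fun i : Γ.supp s => Γ.mult s i * lt i) ↔ ∀ i : Γ.supp s, l i = lt i := by
  rw [funext_iff]
  refine forall_congr' fun i => ?_
  rw [substExponent, mul_right_inj' (Γ.mult_pos s i).ne', toQ]
  norm_cast

theorem eval_PE1coeff_coeff (h : Γ.H) (s : V → ℚ) (lt : Γ.supp s → ℕ) (n : ℤ) :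
    ((Γ.PE1coeff h s lt).eval (-1)).coeff n = ∑ b ∈ Finset.range (Fintype.card V + 1),
      (-1 : ℤ) ^ b * Module.finrank ℤ (Γ.E1 h s lt n b) := by
  rw [PE1coeff, Polynomial.eval_finsetSum, HahnSeries.coeff_sum]
  refine Finset.sum_congr rfl fun b _ => ?_
  rw [Polynomial.eval_monomial, mul_comm, coeff_neg_one_pow_mul, HahnSeries.coeff_ofSuppBddBelow]

theorem eval_PE1coeff {s : V → ℚ} (hs : s ∈ Γ.lipmanCone) (hs0 : s ≠ 0) (h : Γ.H)
    (lt : Γ.supp s → ℕ) :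
    (Γ.PE1coeff h s lt).eval (-1) =
      ∑ l ∈ (Γ.finite_fibre hs hs0 h fun i : Γ.supp s => Γ.mult s i * lt i).toFinset, Γ.Zmcoeff h l := by
  ext n
  set F := (Γ.finite_fibre hs hs0 h fun i : Γ.supp s => Γ.mult s i * lt i).toFinset
  have hF : ∀ l, l ∈ F ↔ (∀ i : Γ.supp s, l i = lt i) ∧ Γ.Zmcoeff h l ≠ 0 := by
    intro l
    rw [Set.Finite.mem_toFinset, Set.mem_ofPred_eq, substExponent_toQ_eq_iff]
  have hGfin : {l : V → ℤ | Γ.chi h l ≤ n ∧ 0 ≤ l ∧ ∀ i : Γ.supp s, l i = lt i}.Finite :=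
    (Γ.finite_setOf_chi_le h n).subset fun l hl => hl.1
  set G := hGfin.toFinset
  have hG : ∀ l, l ∈ G ↔ Γ.chi h l ≤ n ∧ 0 ≤ l ∧ ∀ i : Γ.supp s, l i = lt i :=
    fun l => hGfin.mem_toFinset
  have hchi : ∀ l I, Γ.weight h (l, I) ≤ n → Γ.chi h l ≤ n :=
    fun l I hw => (Γ.chi_base_le_weight h (l, I)).trans hw
  -- `G` bounds only the weight of the base vertex, which makes it finite; the filter imposes the
  -- bound on the whole cube.
  have hcells := sum_neg_one_pow_finrank_relHomology (A := Γ.S h n ∩ Γ.Xmulti s lt)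
    (B := Γ.S h n ∩ Γ.Xmulti s lt ∩ Γ.X s (Γ.deg s lt + 1)) Set.inter_subset_left
    (Γ.finite_setOf_toSet_subset_S h n _)
    ((G ×ˢ (Finset.univ : Finset (Finset V))).filter fun c => Γ.weight h c ≤ n) (by
      rintro ⟨l, I⟩
      rw [Γ.relative_cell_iff h hs, Finset.mem_filter, Finset.mem_product, hG]
      have := hchi l I
      have hu := Finset.mem_univ I
      tauto)
  rw [eval_PE1coeff_coeff, hcells, Finset.sum_filter, Finset.sum_product, HahnSeries.coeff_sum]
  have hG' : ∑ l ∈ G, ∑ I : Finset V, (if Γ.weight h (l, I) ≤ n then (-1 : ℤ) ^ I.card else 0) =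
      ∑ l ∈ G, (Γ.Zmcoeff h l).coeff n :=
    Finset.sum_congr rfl fun l _ => (Γ.coeff_Zmcoeff h l n).symm
  rw [hG']
  -- `F` depends on the support of the whole Laurent series and `G` on the level `n`, so neither
  -- need contain the other. Both sums reduce to the intersection, as the remaining terms have zero
  -- `n`-th coefficient.
  refine (Finset.sum_subset (Finset.inter_subset_left (s₂ := F)) fun l hl hl' => ?_).symm.trans
    (Finset.sum_subset Finset.inter_subset_right fun l hl hl' => ?_)
  · by_contra hne
    refine hl' (Finset.mem_inter.mpr ⟨hl, (hF l).mpr ⟨((hG l).mp hl).2.2, fun h0 => hne ?_⟩⟩)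
    rw [h0, HahnSeries.coeff_zero]
  · by_contra hne
    obtain ⟨hlt, h0⟩ := (hF l).mp hl
    refine hl' (Finset.mem_inter.mpr ⟨(hG l).mpr ⟨?_, Γ.nonneg_of_Zmcoeff_ne_zero h h0, hlt⟩, hl⟩)
    rw [coeff_Zmcoeff] at hne
    obtain ⟨I, _, hI⟩ := Finset.exists_ne_zero_of_sum_ne_zero hne
    exact hchi l I (by_contra fun hw => hI (if_neg hw))

/-! ### Comparison of the two series, monomial by monomial. -/

theorem PE1_mult (h : Γ.H) (s : V → ℚ) (lt : Γ.supp s → ℕ) :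
    Γ.PE1 h s (fun i : Γ.supp s => Γ.mult s i * lt i) = Γ.PE1coeff h s lt := by
  have e : {k : Γ.supp s → ℕ | (fun i : Γ.supp s => Γ.mult s i * k i) =
      fun i : Γ.supp s => Γ.mult s i * lt i} = {lt} := by
    ext k
    rw [Set.mem_ofPred_eq, Set.mem_singleton_iff, funext_iff, funext_iff]
    refine forall_congr' fun i => ?_
    rw [mul_right_inj' (Γ.mult_pos s i).ne', Nat.cast_inj]
  rw [PE1, formalSum, e, finsum_mem_singleton]

theorem PE1AtNegOne_eq {s : V → ℚ} (hs : s ∈ Γ.lipmanCone) (hs0 : s ≠ 0) (h : Γ.H) :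
    Γ.PE1AtNegOne h s =
      substMonomials (Γ.substExponent s) (mulMonomial (Γ.Zm h) (-Γ.sMin h)) := by
  ext1 c
  rw [Γ.substMonomials_mulMonomial_Zm hs hs0, PE1AtNegOne]
  by_cases hc : ∃ lt : Γ.supp s → ℕ, (fun i : Γ.supp s => Γ.mult s i * lt i) = c
  · obtain ⟨lt, rfl⟩ := hc
    rw [PE1_mult, Γ.eval_PE1coeff hs hs0]
  -- For an exponent not of the form `n_i l̃_i` both sides vanish: a contributing lattice point
  -- would be nonnegative, and its support coordinates would provide such an `l̃`.
  · have e : {k : Γ.supp s → ℕ | (fun i : Γ.supp s => Γ.mult s i * k i) = c} = ∅ :=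
      Set.eq_empty_of_forall_notMem fun k hk => hc ⟨k, hk⟩
    rw [PE1, formalSum, e, finsum_mem_empty, Polynomial.eval_zero, Finset.sum_eq_zero]
    intro l hl
    obtain ⟨hlc, hl0⟩ := (Γ.finite_fibre hs hs0 h c).mem_toFinset.mp hl
    refine absurd ⟨fun i => (l i).toNat, ?_⟩ hc
    rw [← hlc, eq_comm, substExponent_toQ_eq_iff]
    exact fun i => (Int.toNat_of_nonneg (Γ.nonneg_of_Zmcoeff_ne_zero h hl0 i)).symm

end ResolutionGraph
end Series
end PlumbingLattice
open PlumbingLattice in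
theorem mainTheorem8 {V : Type*} [Fintype V] [LinearOrder V] (Γ : ResolutionGraph V) (h : Γ.H)
    (s : V → ℚ) (hs : s ∈ Γ.lipmanCone) (hs0 : s ≠ 0) :
    (∀ (lt : Γ.supp s → ℕ) (n : ℤ) (b : ℕ), Module.Finite ℤ (Γ.E1 h s lt n b)) ∧
    Substitutable (Γ.substExponent s) (mulMonomial (Γ.Zm h) (-Γ.sMin h)) ∧
    Γ.PE1AtNegOne h s =
      substMonomials (Γ.substExponent s) (mulMonomial (Γ.Zm h) (-Γ.sMin h)) :=
  ⟨fun _ n _ => finite_relHomology _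
      ((Γ.finite_setOf_toSet_subset_S h n _).subset fun _ hc => hc.2),
    Γ.substitutable_mulMonomial_Zm hs hs0 h, Γ.PE1AtNegOne_eq hs hs0 h⟩
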